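/- Let $\mathcal H$ be a complex Hilbert space (scalar products are antilinear in the first argument) and let $h$ be a self-adjoint, possibly unbounded, operator on $\mathcal H$. Put $\langle h\rangle=(1+h^2)^{1/2}$ and, for $s\ge 0$, let $\langle h\rangle^{-s}\mathcal H=\operatorname{Dom}|h|^{s}$ with the norm $\|\langle h\rangle^{s}u\|$, and let $\langle h\rangle^{s}\mathcal H$ be its adjoint space, i.e. the space of continuous antilinear functionals on $\langle h\rangle^{-s}\mathcal H$, into which $\mathcal H$ is embedded by $u\mapsto(\,\cdot\,|u)$. Assume (A1): $h$ is self-adjoint on $\mathcal H$ and $k:\langle h\rangle^{-1/2}\mathcal H\to\mathcal H$ is bounded and symmetric, i.e. $(ku|v)=(u|kv)$ for all $u,v\in\langle h\rangle^{-1/2}\mathcal H$. Denote again by $k:\mathcal H\to\langle h\rangle^{1/2}\mathcal H$ and $h:\langle h\rangle^{-1/2}\mathcal H\to\langle h\rangle^{1/2}\mathcal H$ the continuous extensions of $k$ and $h$, and put $h_0=h+k^2:\langle h\rangle^{-1/2}\mathcal H\to\langle h\rangle^{1/2}\mathcal H$. Let $$\mathcal E=\langle h\rangle^{-1/2}\mathcal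 H\oplus\mathcal H,\qquad \mathcal E^*=\mathcal H\oplus\langle h\rangle^{1/2}\mathcal H,\qquad \mathcal K_{1/4}=\langle h\rangle^{-1/4}\mathcal H\oplus\langle h\rangle^{1/4}\mathcal H,$$ so that $\mathcal E\subset\mathcal K_{1/4}\subset\mathcal E^*$, and let $\hat K:\mathcal E\to\mathcal E^*$ be the bounded operator $$\hat K\begin{pmatrix}u_0\\u_1\end{pmatrix}=\begin{pmatrix}ku_0+u_1\\h_0u_0+ku_1\end{pmatrix}.$$ The charge Klein–Gordon operator $K_{1/4}$ is the operator induced by $\hat K$ in $\mathcal K_{1/4}$, i.e. the restriction of $\hat K$ to $\operatorname{Dom}K_{1/4}=\{u\in\mathcal E:\hat Ku\in\mathcal K_{1/4}\}$, considered as an operator in $\mathcal K_{1/4}$. If moreover $h$ is bounded below, that is, if there is $c\in\mathbb R$ with $(u|hu)\ge c\|u\|^2$ for all $u\in\operatorname{Dom}h$, then $K_{1/4}$ is the generator of a $C_0$-group: there is a strongly continuous one-parameter group $\{W_t\}_{t\in\mathbb R}$ of bounded operators on $\mathcal K_{1/4}$ such that $u\in\operatorname{Dom}K_{1/4}$ if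 and only if $t\mapsto W_tu$ is differentiable at $0$ in $\mathcal K_{1/4}$, and then $\frac{d}{dt}W_tu|_{t=0}=\mathrm i\,K_{1/4}u$ (that is, $W_t=\mathrm e^{\mathrm itK_{1/4}}$). -/

import Mathlib

open scoped NNReal

noncomputable section

namespace AbstractKG

variable {H : Type*} [NormedAddCommGroup H] [InnerProductSpace ℂ H] [CompleteSpace H]
variable {h : H →ₗ.[ℂ] H}

theorem mem_graph_of_inner (hsa : IsSelfAdjoint h) {b w : H}
    (hbw : ∀ x : h.domain, inner ℂ w (x : H) = inner ℂ b (h x)) : (b, w) ∈ h.graph := by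
  have hd := hsa.dense_domain
  have h1 : b ∈ h.adjoint.domain := LinearPMap.mem_adjoint_domain_of_exists b ⟨w, hbw⟩
  have h2 := LinearPMap.adjoint_apply_eq hd ⟨b, h1⟩ hbw
  rw [← LinearPMap.isSelfAdjoint_def.mp hsa, LinearPMap.mem_graph_iff]
  exact ⟨⟨b, h1⟩, rfl, h2⟩

theorem inner_symm_graph (hsa : IsSelfAdjoint h) {a b c d : H}
    (hab : (a, b) ∈ h.graph) (hcd : (c, d) ∈ h.graph) : inner ℂ b c = inner ℂ a d := by
  have hd := hsa.dense_domain
  have := LinearPMap.adjoint_isFormalAdjoint hd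
  rw [LinearPMap.isSelfAdjoint_def.mp hsa] at this
  rw [LinearPMap.mem_graph_iff] at hab hcd
  obtain ⟨x, rfl, rfl⟩ := hab
  obtain ⟨y, rfl, rfl⟩ := hcd
  exact this x y

/-- The graph of `h` inside the Hilbert space `H ⊕ H`. -/
def graphL2 (h : H →ₗ.[ℂ] H) : Submodule ℂ (WithLp 2 (H × H)) :=
  h.graph.comap (WithLp.linearEquiv 2 ℂ (H × H)).toLinearMap

theorem isClosed_graphL2 (hsa : IsSelfAdjoint h) :
    IsClosed (graphL2 h : Set (WithLp 2 (H × H))) :=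
  IsClosed.preimage (WithLp.prod_continuous_ofLp 2 H H) hsa.isClosed

theorem hasProj (hsa : IsSelfAdjoint h) : (graphL2 h).HasOrthogonalProjection :=
  have : CompleteSpace (graphL2 h) := (isClosed_graphL2 hsa).completeSpace_coe
  inferInstance

/-- The bounded operator `(1 + h²)⁻¹`: the first component of the orthogonal projection of `(u, 0)`
onto the graph of `h` (see `japInvSq_spec`). -/
def japInvSq (hsa : IsSelfAdjoint h) : H →L[ℂ] H :=
  have := hasProj hsa
  (WithLp.fstL 2 ℂ H H ∘L (graphL2 h).starProjection) ∘L
    (((WithLp.prodContinuousLinearEquiv 2 ℂ H H).symm : (H × H) →L[ℂ] WithLp 2 (H × H)) ∘L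
      ContinuousLinearMap.inl ℂ H H)

/-- `(1 + h²)⁻¹ u` is in the domain of `h²` and `(1 + h²) ((1 + h²)⁻¹ u) = u`. -/
theorem japInvSq_spec (hsa : IsSelfAdjoint h) (u : H) :
    ∃ v, (japInvSq hsa u, v) ∈ h.graph ∧ (v, u - japInvSq hsa u) ∈ h.graph := by
  have := hasProj hsa
  set p : WithLp 2 (H × H) := WithLp.toLp 2 (u, 0)
  set q := (graphL2 h).starProjection p with hq
  have e : japInvSq hsa u = q.fst := rfl
  have hqm : q ∈ graphL2 h := Submodule.starProjection_apply_mem _ _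
  refine ⟨q.snd, ?_, ?_⟩
  · rw [e]; exact hqm
  · rw [e]
    apply mem_graph_of_inner hsa
    intro x
    have h1 := Submodule.starProjection_inner_eq_zero (K := graphL2 h) p
      (WithLp.toLp 2 ((x : H), h x)) (h.mem_graph x)
    rw [WithLp.prod_inner_apply] at h1
    simp only [p, ← hq, WithLp.ofLp_sub, Prod.fst_sub, Prod.snd_sub, zero_sub, inner_neg_left] at h1
    exact add_neg_eq_zero.mp h1

theorem japInvSq_unique (hsa : IsSelfAdjoint h) {u y v : H} (h1 : (y, v) ∈ h.graph)
    (h2 : (v, u - y) ∈ h.graph) : y = japInvSq hsa u := by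
  obtain ⟨v', h1', h2'⟩ := japInvSq_spec hsa u
  set y' := japInvSq hsa u
  have a1 : (y - y', v - v') ∈ h.graph := h.graph.sub_mem h1 h1'
  have a2 : (v - v', -(y - y')) ∈ h.graph := by
    have := h.graph.sub_mem h2 h2'
    rw [Prod.mk_sub_mk] at this
    convert this using 2
    abel
  have := inner_symm_graph hsa a1 a2
  rw [inner_neg_right, inner_self_eq_norm_sq_to_K, inner_self_eq_norm_sq_to_K] at this
  have h3 : ‖v - v'‖ ^ 2 = -‖y - y'‖ ^ 2 := by exact_mod_cast this
  have : ‖y - y'‖ = 0 := by nlinarith [sq_nonneg ‖y - y'‖, sq_nonneg ‖v - v'‖]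
  exact sub_eq_zero.mp (norm_eq_zero.mp this)

theorem japInvSq_injective (hsa : IsSelfAdjoint h) : Function.Injective (japInvSq hsa) := by
  rw [injective_iff_map_eq_zero]
  intro u hu
  obtain ⟨v, h1, h2⟩ := japInvSq_spec hsa u
  rw [hu] at h1 h2
  have hv : v = 0 := h.graph_fst_eq_zero_snd h1 rfl
  rw [hv, sub_zero] at h2
  exact h.graph_fst_eq_zero_snd h2 rfl

theorem japInvSq_inner (hsa : IsSelfAdjoint h) {u v w : H}
    (h2 : (v, u - japInvSq hsa u) ∈ h.graph) {x : H} (h3 : (japInvSq hsa w, x) ∈ h.graph) :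
    inner ℂ u (japInvSq hsa w) = inner ℂ (japInvSq hsa u) (japInvSq hsa w) + inner ℂ v x := by
  have := inner_symm_graph hsa h2 h3
  rw [← this, inner_sub_left]; ring

theorem japInvSq_symm (hsa : IsSelfAdjoint h) (u w : H) :
    inner ℂ (japInvSq hsa u) w = inner ℂ u (japInvSq hsa w) := by
  obtain ⟨v, h1, h2⟩ := japInvSq_spec hsa u
  obtain ⟨x, h3, h4⟩ := japInvSq_spec hsa w
  rw [japInvSq_inner hsa h2 h3, ← inner_conj_symm, japInvSq_inner hsa h4 h1, map_add,
    inner_conj_symm, inner_conj_symm]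

theorem japInvSq_nonneg (hsa : IsSelfAdjoint h) : 0 ≤ japInvSq hsa := by
  rw [ContinuousLinearMap.nonneg_iff_isPositive, ContinuousLinearMap.isPositive_def']
  refine ⟨?_, fun u => ?_⟩
  · rw [ContinuousLinearMap.isSelfAdjoint_iff_isSymmetric]
    exact fun u w => japInvSq_symm hsa u w
  · obtain ⟨v, h1, h2⟩ := japInvSq_spec hsa u
    rw [ContinuousLinearMap.reApplyInnerSelf_apply, japInvSq_symm, japInvSq_inner hsa h2 h1,
      inner_self_eq_norm_sq_to_K, inner_self_eq_norm_sq_to_K, map_add]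
    norm_cast
    positivity

/-- `⟨h⟩⁻ˢ = (1 + h²)^(-s/2)`, a bounded operator on `H` for `s ≥ 0`, by the continuous functional
calculus of `(1 + h²)⁻¹`. -/
def japPow (hsa : IsSelfAdjoint h) (s : ℝ≥0) : H →L[ℂ] H := japInvSq hsa ^ ((s : ℝ) / 2)

theorem japPow_add (hsa : IsSelfAdjoint h) (s t : ℝ≥0) :
    japPow hsa (s + t) = japPow hsa s * japPow hsa t := by
  have hp : ∀ r : ℝ≥0, japPow hsa r = cfc (fun x : ℝ≥0 => x ^ ((r : ℝ) / 2)) (japInvSq hsa) :=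
    fun r => CFC.rpow_def
  have hc : ∀ r : ℝ≥0, Continuous (fun x : ℝ≥0 => x ^ ((r : ℝ) / 2)) :=
    fun r => NNReal.continuous_rpow_const (by positivity)
  rw [hp, hp, hp, ← cfc_mul _ _ _ (hc s).continuousOn (hc t).continuousOn]
  congr 1
  ext x
  rw [NNReal.coe_inj, NNReal.coe_add, add_div, NNReal.rpow_add_of_nonneg _ (by positivity) (by positivity)]

theorem japPow_zero (hsa : IsSelfAdjoint h) : japPow hsa 0 = 1 := by
  simp [japPow, CFC.rpow_zero _ (japInvSq_nonneg hsa)]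

theorem japPow_two (hsa : IsSelfAdjoint h) : japPow hsa 2 = japInvSq hsa := by
  simp [japPow, CFC.rpow_one _ (japInvSq_nonneg hsa)]

theorem japPow_natCast_injective (hsa : IsSelfAdjoint h) (n : ℕ) :
    Function.Injective (japPow hsa (n * 2)) := by
  induction n with
  | zero => simpa [japPow_zero] using Function.injective_id
  | succ n ih =>
    rw [Nat.cast_succ, add_mul, one_mul, japPow_add, japPow_two]
    exact ih.comp (japInvSq_injective hsa)

theorem japPow_injective (hsa : IsSelfAdjoint h) (s : ℝ≥0) :
    Function.Injective (japPow hsa s) := by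
  obtain ⟨n, hn⟩ := exists_nat_ge s
  have h1 : s ≤ n * 2 := hn.trans (le_mul_of_one_le_right n.cast_nonneg one_le_two)
  have h2 := japPow_natCast_injective hsa n
  rw [← tsub_add_cancel_of_le h1, japPow_add] at h2
  exact Function.Injective.of_comp h2

theorem japPow_symm (hsa : IsSelfAdjoint h) (s : ℝ≥0) (u w : H) :
    inner ℂ (japPow hsa s u) w = inner ℂ u (japPow hsa s w) := by
  have h1 : 0 ≤ japPow hsa s := CFC.rpow_nonneg
  rw [ContinuousLinearMap.nonneg_iff_isPositive] at h1
  exact h1.isSelfAdjoint.isSymmetric u w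

theorem japPow_denseRange (hsa : IsSelfAdjoint h) (s : ℝ≥0) : DenseRange (japPow hsa s) := by
  have h1 : (LinearMap.range (japPow hsa s).toLinearMap).topologicalClosure = ⊤ := by
    rw [Submodule.topologicalClosure_eq_top_iff, Submodule.eq_bot_iff]
    intro x hx
    rw [Submodule.mem_orthogonal] at hx
    apply japPow_injective hsa s
    rw [map_zero, ← inner_self_eq_zero (𝕜 := ℂ), japPow_symm, ← japPow_symm]
    exact inner_eq_zero_symm.mp (inner_eq_zero_symm.mp (hx _ ⟨_, rfl⟩)) |> fun e => by
      rw [japPow_symm]; exact inner_eq_zero_symm.mp (by simpa using e)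
  have h2 := Submodule.dense_iff_topologicalClosure_eq_top.mpr h1
  exact h2

theorem japPow_one_mul_self (hsa : IsSelfAdjoint h) :
    japPow hsa 1 * japPow hsa 1 = japInvSq hsa := by
  rw [← japPow_add, ← japPow_two hsa]; norm_num

theorem norm_le_of_mem_graph (hsa : IsSelfAdjoint h) {w x : H}
    (h1 : (japInvSq hsa w, x) ∈ h.graph) : ‖x‖ ≤ ‖japPow hsa 1 w‖ := by
  obtain ⟨v, h1', h2⟩ := japInvSq_spec hsa w
  obtain rfl : x = v := h.mem_graph_snd_inj h1 h1' rfl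
  have h3 := japInvSq_inner hsa h2 h1
  rw [← japPow_one_mul_self, mul_apply_eq_comp, ← japPow_symm,
    inner_self_eq_norm_sq_to_K, inner_self_eq_norm_sq_to_K, inner_self_eq_norm_sq_to_K] at h3
  have h4 : ‖japPow hsa 1 w‖ ^ 2 = ‖japPow hsa 1 (japPow hsa 1 w)‖ ^ 2 + ‖x‖ ^ 2 := by
    exact_mod_cast h3
  exact le_of_sq_le_sq (by nlinarith [sq_nonneg ‖japPow hsa 1 (japPow hsa 1 w)‖]) (norm_nonneg _)

theorem exists_boundedTransform (hsa : IsSelfAdjoint h) (u : H) :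
    ∃ y, (japPow hsa 1 u, y) ∈ h.graph ∧ ‖y‖ ≤ ‖u‖ := by
  obtain ⟨a, ha, hau⟩ := mem_closure_iff_seq_limit.mp (japPow_denseRange hsa 1 u)
  choose w hw using ha
  choose x hx _ using fun n => japInvSq_spec hsa (w n)
  have hc : CauchySeq x := by
    have hca := hau.cauchySeq
    rw [Metric.cauchySeq_iff] at hca ⊢
    intro ε hε
    obtain ⟨N, hN⟩ := hca ε hε
    refine ⟨N, fun m hm n hn => lt_of_le_of_lt ?_ (hN m hm n hn)⟩
    rw [dist_eq_norm, dist_eq_norm, ← hw m, ← hw n, ← map_sub]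
    apply norm_le_of_mem_graph hsa
    rw [map_sub]
    exact h.graph.sub_mem (hx m) (hx n)
  obtain ⟨y, hy⟩ := cauchySeq_tendsto_of_complete hc
  refine ⟨y, ?_, ?_⟩
  · have h1 : Filter.Tendsto (fun n => (japPow hsa 1 (a n), x n)) Filter.atTop
        (nhds (japPow hsa 1 u, y)) :=
      (((japPow hsa 1).continuous.tendsto u).comp hau).prodMk_nhds hy
    refine hsa.isClosed.mem_of_tendsto h1 (Filter.Eventually.of_forall fun n => ?_)
    have h2 := hx n
    rwa [← japPow_one_mul_self, mul_apply_eq_comp, hw] at h2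
  · refine le_of_tendsto_of_tendsto' hy.norm hau.norm fun n => ?_
    rw [← hw n]
    exact norm_le_of_mem_graph hsa (hx n)

/-- The bounded operator `h ⟨h⟩⁻¹` on `H`. -/
def boundedTransform (hsa : IsSelfAdjoint h) : H →L[ℂ] H :=
  LinearMap.mkContinuous
    (h.toFun ∘ₗ (japPow hsa 1).toLinearMap.codRestrict h.domain
      (fun u => LinearPMap.mem_domain_of_mem_graph (exists_boundedTransform hsa u).choose_spec.1))
    1 (fun u => by
      obtain ⟨y, h1, h2⟩ := exists_boundedTransform hsa u
      rw [LinearPMap.mem_graph_iff] at h1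
      obtain ⟨x, h3, rfl⟩ := h1
      rw [one_mul]
      have h4 : (⟨japPow hsa 1 u, LinearPMap.mem_domain_of_mem_graph
          (exists_boundedTransform hsa u).choose_spec.1⟩ : h.domain) = x := Subtype.ext h3.symm
      rw [← h4] at h2
      exact h2)

theorem boundedTransform_spec (hsa : IsSelfAdjoint h) (u : H) :
    (japPow hsa 1 u, boundedTransform hsa u) ∈ h.graph :=
  h.mem_graph ⟨japPow hsa 1 u,
    LinearPMap.mem_domain_of_mem_graph (exists_boundedTransform hsa u).choose_spec.1⟩

theorem boundedTransform_comm (hsa : IsSelfAdjoint h) (s : ℝ≥0) (u : H) :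
    boundedTransform hsa (japPow hsa s u) = japPow hsa s (boundedTransform hsa u) := by
  set T := boundedTransform hsa
  set D := japInvSq hsa
  set S := T * japPow hsa 1
  have hS : ∀ u, (D u, S u) ∈ h.graph := fun u => by
    have := boundedTransform_spec hsa (japPow hsa 1 u)
    rwa [← mul_apply_eq_comp, japPow_one_mul_self] at this
  have hS' : ∀ u, (S u, u - D u) ∈ h.graph := fun u => by
    obtain ⟨v, h1, h2⟩ := japInvSq_spec hsa u
    rwa [h.mem_graph_snd_inj (hS u) h1 rfl]
  have hSD : Commute D S := by
    ext u
    exact (japInvSq_unique hsa (hS' (D u)) (by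
      simpa using h.graph.sub_mem (hS u) (hS (D u)))).symm
  have hAS : Commute (japPow hsa s) S := hSD.cfc_nnreal _
  have hA1 : Commute (japPow hsa s) (japPow hsa 1) := by
    rw [Commute, SemiconjBy, ← japPow_add, ← japPow_add, add_comm]
  refine congrFun ((japPow_denseRange hsa 1).equalizer (g := fun u => T (japPow hsa s u))
    (h := fun u => japPow hsa s (T u)) (by fun_prop) (by fun_prop) ?_) u
  ext w
  have e1 := congrArg (fun L : H →L[ℂ] H => L w) hA1.eq
  have e2 := congrArg (fun L : H →L[ℂ] H => L w) hAS.eq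
  simp only [mul_apply_eq_comp, S] at e1 e2
  simp only [Function.comp_apply]
  rw [e1, e2]

theorem boundedTransform_symm (hsa : IsSelfAdjoint h) (z x : H) :
    inner ℂ (boundedTransform hsa z) x = inner ℂ z (boundedTransform hsa x) := by
  refine congrFun ((japPow_denseRange hsa 1).equalizer
    (g := fun z => inner ℂ (boundedTransform hsa z) x)
    (h := fun z => inner ℂ z (boundedTransform hsa x)) (by fun_prop) (by fun_prop) ?_) z
  ext w
  refine congrFun ((japPow_denseRange hsa 1).equalizer
    (g := fun x => inner ℂ (boundedTransform hsa (japPow hsa 1 w)) x)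
    (h := fun x => inner ℂ (japPow hsa 1 w) (boundedTransform hsa x))
    (by fun_prop) (by fun_prop) ?_) x
  ext x
  simp only [Function.comp_apply]
  rw [inner_symm_graph hsa (boundedTransform_spec hsa (japPow hsa 1 w))
    (boundedTransform_spec hsa x), japPow_symm, boundedTransform_comm]

/-- `⟨h⟩⁻¹ H` is the domain of `h`. -/
theorem range_japPow_one (hsa : IsSelfAdjoint h) :
    LinearMap.range (japPow hsa 1).toLinearMap = h.domain := by
  apply le_antisymm
  · rintro _ ⟨u, rfl⟩
    exact LinearPMap.mem_domain_of_mem_graph (boundedTransform_spec hsa u)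
  · intro x hx
    refine ⟨japPow hsa 1 x + boundedTransform hsa (h ⟨x, hx⟩), ?_⟩
    have hxy := h.mem_graph ⟨x, hx⟩
    change japPow hsa 1 (japPow hsa 1 x + boundedTransform hsa (h ⟨x, hx⟩)) = x
    refine ext_inner_right ℂ fun w => ?_
    obtain ⟨v, h1, h2⟩ := japInvSq_spec hsa w
    have h3 := boundedTransform_spec hsa (japPow hsa 1 w)
    rw [← mul_apply_eq_comp, japPow_one_mul_self] at h3
    obtain rfl := h.mem_graph_snd_inj h1 h3 rfl
    have h4 := inner_symm_graph hsa hxy h2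
    rw [japPow_symm, inner_add_left, japPow_symm, ← mul_apply_eq_comp, japPow_one_mul_self,
      boundedTransform_symm, h4, inner_sub_right]
    ring

theorem japPow_half_of_mem_graph (hsa : IsSelfAdjoint h) {x y : H}
    (hxy : (japPow hsa (1 / 2) x, y) ∈ h.graph) :
    japPow hsa (1 / 2) y = boundedTransform hsa x := by
  have hJ : ∀ z, japPow hsa (1 / 2) (japPow hsa (1 / 2) z) = japPow hsa 1 z := fun z => by
    rw [← mul_apply_eq_comp, ← japPow_add, add_halves]
  refine (japPow_denseRange hsa (1 / 2)).eq_of_inner_right ℂ fun z => ?_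
  rw [← japPow_symm, hJ, ← inner_symm_graph hsa (boundedTransform_spec hsa z) hxy, ← japPow_symm,
    ← boundedTransform_comm, boundedTransform_symm hsa]

/-! ### Antiduals -/

/-- The adjoint space of `X`: continuous antilinear functionals. -/
abbrev AntiDual (X : Type*) [NormedAddCommGroup X] [NormedSpace ℂ X] : Type _ := X →L⋆[ℂ] ℂ

section antidual

variable {X Y Z : Type*} [NormedAddCommGroup X] [NormedSpace ℂ X]
  [NormedAddCommGroup Y] [NormedSpace ℂ Y] [NormedAddCommGroup Z] [NormedSpace ℂ Z]

/-- The adjoint `w ↦ w ∘ L` of a bounded operator `L`. -/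
def adjointMap (L : X →L[ℂ] Y) : AntiDual Y →L[ℂ] AntiDual X :=
  (ContinuousLinearMap.compSL X Y ℂ (RingHom.id ℂ) (starRingEnd ℂ)).flip L

@[simp] theorem adjointMap_apply (L : X →L[ℂ] Y) (w : AntiDual Y) (x : X) :
    adjointMap L w x = w (L x) := rfl

/-- The Riesz identification `u ↦ (v ↦ (v | u))` of a Hilbert space with its adjoint space. -/
def riesz {E : Type*} [NormedAddCommGroup E] [InnerProductSpace ℂ E] : E →L[ℂ] AntiDual E :=
  (innerSL ℂ).flip

theorem adjointMap_injective {L : X →L[ℂ] Y} (hL : DenseRange L) :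
    Function.Injective (adjointMap L) := by
  intro w w' hw
  ext y
  refine congrFun (hL.equalizer (g := w) (h := w') w.continuous w'.continuous ?_) y
  ext x
  exact congrArg (fun f : AntiDual X => f x) hw

end antidual

/-! ### Sobolev spaces -/

/-- The space `⟨h⟩⁻ˢ H = Dom |h|ˢ`, `s ≥ 0`, i.e. the range of `⟨h⟩⁻ˢ`; its norm is
`‖⟨h⟩ˢ u‖`. -/
def Sob (hsa : IsSelfAdjoint h) (s : ℝ≥0) : Type _ := LinearMap.range (japPow hsa s).toLinearMap

namespace Sob

variable (hsa : IsSelfAdjoint h) (s : ℝ≥0)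

instance : AddCommGroup (Sob hsa s) :=
  inferInstanceAs (AddCommGroup (LinearMap.range (japPow hsa s).toLinearMap))

instance : Module ℂ (Sob hsa s) :=
  inferInstanceAs (Module ℂ (LinearMap.range (japPow hsa s).toLinearMap))

/-- The bijection `⟨h⟩ˢ : ⟨h⟩⁻ˢ H → H`. -/
def japEquiv : Sob hsa s ≃ₗ[ℂ] H :=
  (LinearEquiv.ofInjective (japPow hsa s).toLinearMap (japPow_injective hsa s)).symm

instance : NormedAddCommGroup (Sob hsa s) :=
  NormedAddCommGroup.induced (Sob hsa s) H (japEquiv hsa s).toLinearMap (japEquiv hsa s).injective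

instance : NormedSpace ℂ (Sob hsa s) :=
  NormedSpace.induced ℂ (Sob hsa s) H (japEquiv hsa s).toLinearMap

/-- `⟨h⟩ˢ` as a unitary operator `⟨h⟩⁻ˢ H → H`. -/
def jap : Sob hsa s ≃ₗᵢ[ℂ] H := ⟨japEquiv hsa s, fun _ => rfl⟩

theorem norm_def (u : Sob hsa s) : ‖u‖ = ‖jap hsa s u‖ := rfl

instance : CompleteSpace (Sob hsa s) := 
  ((jap hsa s).isometry.isUniformInducing.completeSpace_congr (jap hsa s).surjective).mpr inferInstance

/-- The embedding `⟨h⟩⁻ˢ H ⊂ H`. -/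
def incl : Sob hsa s →L[ℂ] H :=
  (japPow hsa s) ∘L ((jap hsa s).toContinuousLinearEquiv : Sob hsa s →L[ℂ] H)

theorem incl_eq (u : Sob hsa s) :
    incl hsa s u = ((show LinearMap.range (japPow hsa s).toLinearMap from u) : H) :=
  congrArg Subtype.val ((LinearEquiv.ofInjective (japPow hsa s).toLinearMap
    (japPow_injective hsa s)).apply_symm_apply u)

@[simp] theorem incl_jap_symm (x : H) : incl hsa s ((jap hsa s).symm x) = japPow hsa s x := by
  simp [incl]

theorem incl_injective : Function.Injective (incl hsa s) :=
  (japPow_injective hsa s).comp (jap hsa s).injective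

theorem incl_denseRange : DenseRange (incl hsa s) :=
  (japPow_denseRange hsa s).comp (jap hsa s).surjective.denseRange (japPow hsa s).continuous

/-- The embedding `⟨h⟩⁻ᵗ H ⊂ ⟨h⟩⁻ˢ H` for `s ≤ t` (see `incl_inclLE`). -/
def inclLE {s t : ℝ≥0} (_hst : s ≤ t) : Sob hsa t →L[ℂ] Sob hsa s :=
  ((jap hsa s).symm.toContinuousLinearEquiv : H →L[ℂ] Sob hsa s) ∘L japPow hsa (t - s) ∘L
    ((jap hsa t).toContinuousLinearEquiv : Sob hsa t →L[ℂ] H)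

theorem incl_inclLE {s t : ℝ≥0} (hst : s ≤ t) (u : Sob hsa t) :
    incl hsa s (inclLE hsa hst u) = incl hsa t u := by
  obtain ⟨x, rfl⟩ := (jap hsa t).symm.surjective u
  have : inclLE hsa hst ((jap hsa t).symm x) = (jap hsa s).symm (japPow hsa (t - s) x) := by
    simp [inclLE]
  rw [this, incl_jap_symm, incl_jap_symm, ← mul_apply_eq_comp, ← japPow_add,
    add_tsub_cancel_of_le hst]

theorem inclLE_injective {s t : ℝ≥0} (hst : s ≤ t) : Function.Injective (inclLE hsa hst) :=
  fun u v huv => incl_injective hsa t (by rw [← incl_inclLE hsa hst, huv, incl_inclLE])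

theorem inclLE_denseRange {s t : ℝ≥0} (hst : s ≤ t) : DenseRange (inclLE hsa hst) :=
  ((jap hsa s).symm.surjective.denseRange.comp (japPow_denseRange hsa (t - s))
    (jap hsa s).symm.continuous).comp (jap hsa t).surjective.denseRange
    ((jap hsa s).symm.continuous.comp (japPow hsa (t - s)).continuous)

/-- The embedding `H ⊂ ⟨h⟩ˢ H := (⟨h⟩⁻ˢ H)*`, `u ↦ (v ↦ (v | u))`. -/
def toDual : H →L[ℂ] AntiDual (Sob hsa s) := adjointMap (incl hsa s) ∘L riesz

@[simp] theorem toDual_apply (u : H) (v : Sob hsa s) : toDual hsa s u v = inner ℂ (incl hsa s v) u := rfl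

theorem toDual_injective : Function.Injective (toDual hsa s) := fun _ _ huv =>
  (incl_denseRange hsa s).eq_of_inner_right ℂ fun x =>
    congrArg (fun f : AntiDual (Sob hsa s) => f x) huv

/-- The continuous extension `⟨h⟩^(-1/2) H → ⟨h⟩^(1/2) H` of `h` (see `hExt_of_mem_graph`), given by
`(v | h u) = (⟨h⟩^(1/2) v | h ⟨h⟩⁻¹ ⟨h⟩^(1/2) u)`. -/
def hExt : Sob hsa (1 / 2) →L[ℂ] AntiDual (Sob hsa (1 / 2)) :=
  adjointMap ((jap hsa (1 / 2)).toContinuousLinearEquiv : Sob hsa (1 / 2) →L[ℂ] H) ∘L riesz ∘L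
    boundedTransform hsa ∘L ((jap hsa (1 / 2)).toContinuousLinearEquiv : Sob hsa (1 / 2) →L[ℂ] H)

theorem hExt_apply (u v : Sob hsa (1 / 2)) :
    hExt hsa u v = inner ℂ (jap hsa (1 / 2) v) (boundedTransform hsa (jap hsa (1 / 2) u)) := rfl

theorem hExt_of_mem_graph {u : Sob hsa (1 / 2)} {y : H} (huy : (incl hsa (1 / 2) u, y) ∈ h.graph) :
    hExt hsa u = toDual hsa (1 / 2) y := by
  ext v
  obtain ⟨x, rfl⟩ := (jap hsa (1 / 2)).symm.surjective u
  obtain ⟨z, rfl⟩ := (jap hsa (1 / 2)).symm.surjective v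
  rw [incl_jap_symm] at huy
  rw [hExt_apply, toDual_apply, incl_jap_symm, LinearIsometryEquiv.apply_symm_apply,
    LinearIsometryEquiv.apply_symm_apply, ← japPow_half_of_mem_graph hsa huy, japPow_symm]

end Sob

/-! ### Induced operators and generators of groups -/

section operators

variable {X Y Z : Type*} [NormedAddCommGroup X] [NormedSpace ℂ X]
  [NormedAddCommGroup Y] [NormedSpace ℂ Y] [NormedAddCommGroup Z] [NormedSpace ℂ Z]

/-- The operator induced in `Y` by `S : X → Z`, where `X ⊂ Y ⊂ Z` through the injections `i`, `j`:
the restriction of `S` to `{x ∈ X | S x ∈ Y}`, as an operator in `Y`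
(see `mem_graph_inducedOperator`). -/
def inducedOperator (i : X →L[ℂ] Y) (j : Y →L[ℂ] Z) (S : X →L[ℂ] Z) : Y →ₗ.[ℂ] Y :=
  Submodule.toLinearPMap
    (((LinearMap.eqLocus (S.toLinearMap ∘ₗ LinearMap.fst ℂ X Y)
      (j.toLinearMap ∘ₗ LinearMap.snd ℂ X Y))).map (i.toLinearMap.prodMap LinearMap.id))

theorem mem_graph_inducedOperator {i : X →L[ℂ] Y} {j : Y →L[ℂ] Z} {S : X →L[ℂ] Z}
    (hi : Function.Injective i) (hj : Function.Injective j) {y y' : Y} :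
    (y, y') ∈ (inducedOperator i j S).graph ↔ ∃ x, i x = y ∧ S x = j y' := by
  rw [inducedOperator, Submodule.toLinearPMap_graph_eq]
  · constructor
    · rintro ⟨⟨x, y''⟩, h1, h2⟩
      obtain ⟨rfl, rfl⟩ := Prod.mk.inj h2
      exact ⟨x, rfl, h1⟩
    · rintro ⟨x, rfl, h1⟩
      exact ⟨(x, y'), h1, rfl⟩
  · rintro _ ⟨⟨x, y''⟩, h1, rfl⟩ h2
    have hx : x = 0 := hi (by simpa using h2)
    apply hj
    have h3 : S x = j y'' := h1
    rw [hx, map_zero] at h3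
    simpa using h3.symm

/-- A `C₀`-group `{W t}` of bounded operators on `X`; `W.op t` is the operator `W t`. -/
structure C0Group (X : Type*) [NormedAddCommGroup X] [NormedSpace ℂ X] where
  op : ℝ → X →L[ℂ] X
  op_zero : op 0 = ContinuousLinearMap.id ℂ X
  op_add : ∀ s t, op (s + t) = op s ∘L op t
  continuous_op : ∀ x, Continuous fun t => op t x

/-- The generator `A` of a `C₀`-group, with the convention `W t = exp (i t A)`:
its domain consists of the `x` for which `t ↦ W t x` is differentiable at `0`, and
`A x = -i (d/dt) W t x` at `t = 0`. -/
def C0Group.generator {X : Type*} [NormedAddCommGroup X] [NormedSpace ℂ X] (W : C0Group X) :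
    X →ₗ.[ℂ] X where
  domain :=
    { carrier := {x | DifferentiableAt ℝ (fun t => W.op t x) 0}
      zero_mem' := by simp
      add_mem' := fun {x y} hx hy =>
        (hx.add hy).congr_of_eventuallyEq (.of_forall fun t => map_add (W.op t) x y)
      smul_mem' := fun c x hx =>
        (hx.const_smul c).congr_of_eventuallyEq (.of_forall fun t => map_smul (W.op t) c x) }
  toFun :=
    { toFun := fun x => -Complex.I • deriv (fun t => W.op t (x : X)) 0
      map_add' := fun x y => by
        have hx : DifferentiableAt ℝ (fun t => W.op t (x : X)) 0 := x.2
        have hy : DifferentiableAt ℝ (fun t => W.op t (y : X)) 0 := y.2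
        have he : deriv (fun t => W.op t ((x : X) + (y : X))) 0
            = deriv (fun t => W.op t (x : X)) 0 + deriv (fun t => W.op t (y : X)) 0 :=
          ((hx.hasDerivAt.add hy.hasDerivAt).congr_of_eventuallyEq
            (.of_forall fun t => map_add (W.op t) (x : X) y)).deriv
        rw [Submodule.coe_add, he, smul_add]
      map_smul' := fun c x => by
        have hx : DifferentiableAt ℝ (fun t => W.op t (x : X)) 0 := x.2
        have he : deriv (fun t => W.op t (c • (x : X))) 0
            = c • deriv (fun t => W.op t (x : X)) 0 :=
          ((hx.hasDerivAt.const_smul c).congr_of_eventuallyEq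
            (.of_forall fun t => map_smul (W.op t) c (x : X))).deriv
        rw [Submodule.coe_smul, he, smul_comm, RingHom.id_apply] }

theorem C0Group.mem_graph_generator {X : Type*} [NormedAddCommGroup X] [NormedSpace ℂ X]
    (W : C0Group X) {x y : X} :
    (x, y) ∈ W.generator.graph ↔ HasDerivAt (fun t => W.op t x) (Complex.I • y) 0 := by
  rw [LinearPMap.mem_graph_iff]
  constructor
  · rintro ⟨x, rfl, rfl⟩
    have h1 : DifferentiableAt ℝ (fun t => W.op t (x : X)) 0 := x.2
    convert h1.hasDerivAt using 1
    change Complex.I • -Complex.I • deriv (fun t => W.op t (x : X)) 0 = _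
    simp [smul_smul]
  · intro hd
    refine ⟨⟨x, hd.differentiableAt⟩, rfl, ?_⟩
    change -Complex.I • deriv (fun t => W.op t x) 0 = y
    rw [hd.deriv]
    simp [smul_smul]

end operators

/-! ### The Klein-Gordon operators -/

variable (hsa : IsSelfAdjoint h)

/-- The energy space `⟨h⟩^(-1/2) H ⊕ H`. -/
abbrev EnergySpace : Type _ := Sob hsa (1 / 2) × H

/-- The adjoint space `H ⊕ ⟨h⟩^(1/2) H` of the energy space. -/
abbrev EnergySpaceDual : Type _ := H × AntiDual (Sob hsa (1 / 2))

/-- The charge space `⟨h⟩^(-θ) H ⊕ ⟨h⟩^θ H` of order `θ`. -/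
abbrev ChargeSpace (θ : ℝ≥0) : Type _ := Sob hsa θ × AntiDual (Sob hsa θ)

/-- `k : ⟨h⟩^(-1/2) H → H` is symmetric. -/
def SymmetricOnSob (k : Sob hsa (1 / 2) →L[ℂ] H) : Prop :=
  ∀ u v, inner ℂ (k u) (Sob.incl hsa (1 / 2) v) = inner ℂ (Sob.incl hsa (1 / 2) u) (k v)

/-- The continuous extension `H → ⟨h⟩^(1/2) H` of a symmetric `k : ⟨h⟩^(-1/2) H → H`
(see `kExt_incl`). -/
def kExt (k : Sob hsa (1 / 2) →L[ℂ] H) : H →L[ℂ] AntiDual (Sob hsa (1 / 2)) :=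
  adjointMap k ∘L riesz

theorem kExt_incl {k : Sob hsa (1 / 2) →L[ℂ] H} (hk : SymmetricOnSob hsa k)
    (u : Sob hsa (1 / 2)) :
    kExt hsa k (Sob.incl hsa (1 / 2) u) = Sob.toDual hsa (1 / 2) (k u) := by
  ext v
  exact hk v u

/-- `h₀ = h + k² : ⟨h⟩^(-1/2) H → ⟨h⟩^(1/2) H`. -/
def hZero (k : Sob hsa (1 / 2) →L[ℂ] H) : Sob hsa (1 / 2) →L[ℂ] AntiDual (Sob hsa (1 / 2)) :=
  Sob.hExt hsa + kExt hsa k ∘L k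

/-- The Klein-Gordon operator `(u₀, u₁) ↦ (k u₀ + u₁, h₀ u₀ + k u₁)` from the energy space to its
adjoint space. -/
def kgOperator (k : Sob hsa (1 / 2) →L[ℂ] H) : EnergySpace hsa →L[ℂ] EnergySpaceDual hsa :=
  (k.coprod (ContinuousLinearMap.id ℂ H)).prod ((hZero hsa k).coprod (kExt hsa k))

theorem kgOperator_apply (k : Sob hsa (1 / 2) →L[ℂ] H) (u : EnergySpace hsa) :
    kgOperator hsa k u = (k u.1 + u.2, hZero hsa k u.1 + kExt hsa k u.2) := rfl

/-- The embedding of the energy space into the charge space of order `θ ≤ 1/2`. -/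
def energyToCharge {θ : ℝ≥0} (hθ : θ ≤ 1 / 2) : EnergySpace hsa →L[ℂ] ChargeSpace hsa θ :=
  (Sob.inclLE hsa hθ).prodMap (Sob.toDual hsa θ)

/-- The embedding of the charge space of order `θ ≤ 1/2` into the adjoint of the energy space. -/
def chargeToDual {θ : ℝ≥0} (hθ : θ ≤ 1 / 2) : ChargeSpace hsa θ →L[ℂ] EnergySpaceDual hsa :=
  (Sob.incl hsa θ).prodMap (adjointMap (Sob.inclLE hsa hθ))

/-- The charge Klein-Gordon operator `K_θ`, `0 ≤ θ ≤ 1/2`: the operator induced in the charge space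
of order `θ` by the Klein-Gordon operator. -/
def chargeKG (k : Sob hsa (1 / 2) →L[ℂ] H) {θ : ℝ≥0} (hθ : θ ≤ 1 / 2) :
    ChargeSpace hsa θ →ₗ.[ℂ] ChargeSpace hsa θ :=
  inducedOperator (energyToCharge hsa hθ) (chargeToDual hsa hθ) (kgOperator hsa k)

theorem mem_graph_chargeKG (k : Sob hsa (1 / 2) →L[ℂ] H) {θ : ℝ≥0} (hθ : θ ≤ 1 / 2)
    {u w : ChargeSpace hsa θ} :
    (u, w) ∈ (chargeKG hsa k hθ).graph ↔
      ∃ x : EnergySpace hsa, energyToCharge hsa hθ x = u ∧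
        kgOperator hsa k x = chargeToDual hsa hθ w :=
  mem_graph_inducedOperator
    ((Sob.inclLE_injective hsa hθ).prodMap (Sob.toDual_injective hsa θ))
    ((Sob.incl_injective hsa θ).prodMap (adjointMap_injective (Sob.inclLE_denseRange hsa hθ)))

/-- `h` is bounded below: `(u | h u) ≥ c ‖u‖²` on the domain of `h`, for some real `c`. -/
def BoundedBelow (h : H →ₗ.[ℂ] H) : Prop :=
  ∃ c : ℝ, ∀ u : h.domain, c * ‖(u : H)‖ ^ 2 ≤ (inner ℂ (u : H) (h u)).re

theorem quarter_le_half : (1 / 4 : ℝ≥0) ≤ 1 / 2 := by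
  rw [← NNReal.coe_le_coe]
  push_cast
  norm_num

end AbstractKG

end

open scoped NNReal

noncomputable section

namespace AbstractKG

open Filter Topology

/-! The operator iK, K = K_{1/4}, is treated by the Hille–Yosida theorem for groups: what is needed
are inverses of l − iK for real l with |l| large, and a bound ‖(l − iK)⁻ⁿ‖ ≤ M(|l| − ω)⁻ⁿ with M
independent of n.

Eliminating u₁ from (l − iK̂)u = w leaves the quadratic pencil h − 2ilk + l² for u₀. Since (u₀|ku₀)
is real, the k-term does not affect the real part of the form, which is coercive on the form domain
of h as soon as l² dominates the lower bound of h (`kgPencil_isUnit`). So l − iK̂ : E → E* is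
bijective.

The power bound is proved on the energy space E and carried over to the charge space. On E the norm
is equivalent to that of the positive energy ‖ku₀ + u₁‖² + (u₀|(h+c)u₀). For c = 0 the operator
would be symmetric for the energy, and the shift c contributes only a bounded error, whence (|l| −
ω)‖x‖ ≤ ‖(l − iK)x‖ in energy norm (`norm_energyMap_le`), an inequality that iterates without loss.

On the charge space there is no positive conserved form, but K̂ is symmetric for the indefinite
charge (u₀|v₁) + (u₁|v₀), so the charge adjoint of (l − iK)⁻¹ is −(−l − iK)⁻¹. The inner product of
the charge space of order 1/4 is the charge form composed with an involution that is bounded on E.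
Hence the powers of the resolvent and their adjoints for this weaker inner product are both bounded
on E, and Lax's argument (`norm_apply_le_of_formalAdjoint`) gives the same power bound in the charge
norm (`norm_charge_pow_le`). The generation theorem itself is proved by Yosida approximation
(`IsResolventFamily.exists_c0Group`). -/

section hilleYosida

variable {X : Type*} [NormedAddCommGroup X] [NormedSpace ℂ X]

/-! ### Groups with bounded generators -/

/-- The group `t ↦ exp (t P)` generated by a bounded operator `P`. -/
def expGroup (P : X →L[ℂ] X) (t : ℝ) : X →L[ℂ] X := NormedSpace.exp (t • P)

theorem expGroup_zero (P : X →L[ℂ] X) : expGroup P 0 = 1 := by simp [expGroup]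

theorem norm_neg_pow (A : X →L[ℂ] X) (n : ℕ) : ‖(-A) ^ n‖ = ‖A ^ n‖ := by
  rw [neg_pow]
  rcases neg_one_pow_eq_or (X →L[ℂ] X) n with h | h <;> rw [h] <;> simp

theorem commute_expGroup {L P : X →L[ℂ] X} (hLP : Commute L P) (t : ℝ) :
    Commute L (expGroup P t) :=
  (hLP.smul_right t).exp_right

theorem apply_comm_of_commute {S T : X →L[ℂ] X} (hST : Commute S T) (x : X) : S (T x) = T (S x) :=
  congrArg (fun L : X →L[ℂ] X => L x) hST.eq

variable [CompleteSpace X]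

theorem expGroup_add (P : X →L[ℂ] X) (s t : ℝ) :
    expGroup P (s + t) = expGroup P s * expGroup P t := by
  let +nondep : NormedAlgebra ℚ (X →L[ℂ] X) := .restrictScalars ℚ ℝ (X →L[ℂ] X)
  rw [expGroup, add_smul, NormedSpace.exp_add_of_commute]
  · rfl
  · exact ((Commute.refl P).smul_left s).smul_right t

theorem hasDerivAt_expGroup_apply (P : X →L[ℂ] X) (x : X) (t : ℝ) :
    HasDerivAt (fun s => expGroup P s x) (expGroup P t (P x)) t := by
  have h1 := hasDerivAt_exp_smul_const (𝕂 := ℝ) P t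
  exact ((ContinuousLinearMap.apply ℂ X x).restrictScalars ℝ).hasFDerivAt.comp_hasDerivAt t h1

theorem hasDerivAt_expGroup_mul_apply (P Q : X →L[ℂ] X) (x : X) (t : ℝ) :
    HasDerivAt (fun s => expGroup P s (expGroup Q s x))
      (expGroup P t (P (expGroup Q t x)) + expGroup P t (expGroup Q t (Q x))) t := by
  have h1 := (hasDerivAt_exp_smul_const (𝕂 := ℝ) P t).mul (hasDerivAt_exp_smul_const (𝕂 := ℝ) Q t)
  exact ((ContinuousLinearMap.apply ℂ X x).restrictScalars ℝ).hasFDerivAt.comp_hasDerivAt t h1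

/-- Since P and Q commute, e^{sP}e^{sQ}x has derivative e^{sP}e^{sQ}(P + Q)x. With P and Q
approximating A and −A, this shows that the two limit semigroups are mutually inverse. -/
theorem norm_expGroup_mul_sub_le {P Q : X →L[ℂ] X} (hPQ : Commute P Q) {C t : ℝ} (ht : 0 ≤ t)
    (hP : ∀ s, 0 ≤ s → s ≤ t → ‖expGroup P s‖ ≤ C) (hQ : ∀ s, 0 ≤ s → s ≤ t → ‖expGroup Q s‖ ≤ C)
    (x : X) : ‖expGroup P t (expGroup Q t x) - x‖ ≤ C * (C * ‖P x + Q x‖) * t := by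
  have hC : 0 ≤ C := (norm_nonneg _).trans (hP 0 le_rfl ht)
  have h1 := norm_image_sub_le_of_norm_deriv_le_segment' (a := 0) (b := t)
    (C := C * (C * ‖P x + Q x‖))
    (fun s _ => (hasDerivAt_expGroup_mul_apply P Q x s).hasDerivWithinAt) (fun s hs => by
      rw [apply_comm_of_commute (commute_expGroup hPQ s), ← map_add, ← map_add]
      refine (ContinuousLinearMap.le_of_opNorm_le _ (hP s hs.1 hs.2.le) _).trans ?_
      gcongr
      exact ContinuousLinearMap.le_of_opNorm_le _ (hQ s hs.1 hs.2.le) _) t ⟨ht, le_rfl⟩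
  simpa [expGroup_zero] using h1

/-- Duhamel's principle: e^{sP}e^{(t−s)Q}x joins the two vectors and has derivative
e^{sP}e^{(t−s)Q}(P − Q)x. -/
theorem norm_expGroup_sub_expGroup_le {P Q : X →L[ℂ] X} (hPQ : Commute P Q) {C t : ℝ} (ht : 0 ≤ t)
    (hP : ∀ s, 0 ≤ s → s ≤ t → ‖expGroup P s‖ ≤ C) (hQ : ∀ s, 0 ≤ s → s ≤ t → ‖expGroup Q s‖ ≤ C)
    (x : X) : ‖expGroup P t x - expGroup Q t x‖ ≤ C * (C * ‖P x - Q x‖) * t := by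
  have hC : 0 ≤ C := (norm_nonneg _).trans (hP 0 le_rfl ht)
  have hd : ∀ s, HasDerivAt (fun s => expGroup P s (expGroup Q (t - s) x))
      (expGroup P s (expGroup Q (t - s) (P x - Q x))) s := fun s => by
    have h0 : ∀ r, expGroup (-Q) r = expGroup Q (-r) := fun r => by simp [expGroup]
    have h1 := hasDerivAt_expGroup_mul_apply P (-Q) (expGroup Q t x) s
    have h2 : ∀ r z, expGroup (-Q) r (expGroup Q t z) = expGroup Q (t - r) z := fun r z => by
      rw [h0, sub_eq_neg_add, expGroup_add]; rfl
    simp only [neg_apply, ← apply_comm_of_commute (commute_expGroup (Commute.refl Q) t).symm,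
      map_neg, h2] at h1
    convert h1 using 1
    rw [apply_comm_of_commute (commute_expGroup hPQ (t - s)), map_sub, map_sub, sub_eq_add_neg]
  have h1 := norm_image_sub_le_of_norm_deriv_le_segment' (a := 0) (b := t)
    (C := C * (C * ‖P x - Q x‖)) (fun s _ => (hd s).hasDerivWithinAt) (fun s hs => by
      refine (ContinuousLinearMap.le_of_opNorm_le _ (hP s hs.1 hs.2.le) _).trans ?_
      gcongr
      exact ContinuousLinearMap.le_of_opNorm_le _
        (hQ (t - s) (by linarith [hs.2]) (by linarith [hs.1])) _) t ⟨ht, le_rfl⟩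
  simpa [expGroup_zero] using h1

theorem norm_expGroup_sub_le {P : X →L[ℂ] X} {C t : ℝ} (ht : 0 ≤ t)
    (hP : ∀ s, 0 ≤ s → s ≤ t → ‖expGroup P s‖ ≤ C) (x : X) :
    ‖expGroup P t x - x‖ ≤ C * ‖P x‖ * t := by
  have h1 := norm_image_sub_le_of_norm_deriv_le_segment' (a := 0) (b := t)
    (C := C * ‖P x‖) (fun s _ => (hasDerivAt_expGroup_apply P x s).hasDerivWithinAt)
    (fun s hs => ContinuousLinearMap.le_of_opNorm_le _ (hP s hs.1 hs.2.le) _) t ⟨ht, le_rfl⟩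
  simpa [expGroup_zero] using h1

/-- Differentiability at 0 in a form that survives a limit in P. Here y stands for the limit of Px
and need not lie in the domain of the limit operator; z is an approximation of y that does, so that
Pz stays bounded along the sequence. -/
theorem norm_expGroup_sub_sub_smul_le {P : X →L[ℂ] X} {C t : ℝ} (ht : 0 ≤ t)
    (hP : ∀ s, 0 ≤ s → s ≤ t → ‖expGroup P s‖ ≤ C) (x y z : X) :
    ‖expGroup P t x - x - t • y‖ ≤ (C * ‖P x - y‖ + (C + 1) * ‖y - z‖ + C * ‖P z‖ * t) * t := by
  have hC : 0 ≤ C := (norm_nonneg _).trans (hP 0 le_rfl ht)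
  have h1 := norm_image_sub_le_of_norm_deriv_le_segment' (a := 0) (b := t)
    (C := C * ‖P x - y‖ + (C + 1) * ‖y - z‖ + C * ‖P z‖ * t)
    (fun s _ => ((hasDerivAt_expGroup_apply P x s).sub
      ((hasDerivAt_id s).smul_const y)).hasDerivWithinAt)
    (fun s hs => by
      have e : expGroup P s (P x) - (1 : ℝ) • y =
          expGroup P s (P x - y) + expGroup P s (y - z) - (y - z) + (expGroup P s z - z) := by
        rw [map_sub, map_sub, one_smul]; abel
      have hs' := hP s hs.1 hs.2.le
      have a1 := ContinuousLinearMap.le_of_opNorm_le _ hs' (P x - y)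
      have a2 := ContinuousLinearMap.le_of_opNorm_le _ hs' (y - z)
      have a3 := norm_expGroup_sub_le (P := P) hs.1 (fun r h1 h2 => hP r h1 (h2.trans hs.2.le)) z
      have a4 : C * ‖P z‖ * s ≤ C * ‖P z‖ * t :=
        mul_le_mul_of_nonneg_left hs.2.le (by positivity)
      rw [e]
      refine (norm_add_le _ _).trans ?_
      have a5 := norm_sub_le (expGroup P s (P x - y) + expGroup P s (y - z)) (y - z)
      have a6 := norm_add_le (expGroup P s (P x - y)) (expGroup P s (y - z))
      linarith) t ⟨ht, le_rfl⟩
  simp only [expGroup_zero, Pi.sub_apply, id, zero_smul, sub_zero] at h1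
  rw [sub_right_comm]
  exact h1

/-- The factor e^{−tb} splits off, and the power bound is inserted termwise in the exponential
series of taR. A bound on ‖R‖ alone would put M into the exponent. -/
theorem norm_expGroup_smul_sub_le {R : X →L[ℂ] X} {M r a t : ℝ} (ht : 0 ≤ t) (ha : 0 ≤ a)
    (hR : ∀ j, ‖R ^ j‖ ≤ M * r ^ j) (b : ℝ) :
    ‖expGroup (a • R - b • (1 : X →L[ℂ] X)) t‖ ≤ M * Real.exp (t * (a * r - b)) := by
  have hM : 0 ≤ M := by have := (norm_nonneg _).trans (hR 0); simpa using this
  have e1 : ‖expGroup R (t * a)‖ ≤ M * Real.exp (t * a * r) := by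
    have h1 := NormedSpace.exp_series_hasSum_exp' (𝕂 := ℝ) (t * a * r)
    rw [← Real.exp_eq_exp_ℝ] at h1
    rw [expGroup, NormedSpace.exp_eq_tsum ℝ]
    refine tsum_of_norm_bounded (h1.mul_left M) fun j => ?_
    rw [smul_pow, norm_smul, norm_smul, norm_inv, Real.norm_natCast, norm_pow, Real.norm_eq_abs,
      abs_of_nonneg (mul_nonneg ht ha), smul_eq_mul, mul_pow (t * a) r]
    have h2 : (0:ℝ) ≤ (j.factorial : ℝ)⁻¹ * (t * a) ^ j := by positivity
    nlinarith [mul_le_mul_of_nonneg_left (hR j) h2]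
  have e2 : expGroup (a • R - b • (1 : X →L[ℂ] X)) t
      = Real.exp (-(t * b)) • expGroup R (t * a) := by
    let +nondep : NormedAlgebra ℚ (X →L[ℂ] X) := .restrictScalars ℚ ℝ (X →L[ℂ] X)
    rw [expGroup, smul_sub, smul_smul, smul_smul, sub_eq_neg_add, NormedSpace.exp_add_of_commute,
      ← neg_smul, ← Algebra.algebraMap_eq_smul_one, ← NormedSpace.algebraMap_exp_comm,
      ← Real.exp_eq_exp_ℝ, Algebra.algebraMap_eq_smul_one, smul_mul_assoc, one_mul]
    · rfl
    · rw [← neg_smul]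
      exact ((Commute.one_left R).smul_left _).smul_right _
  rw [e2, norm_smul, Real.norm_eq_abs, Real.abs_exp]
  calc _ ≤ Real.exp (-(t * b)) * (M * Real.exp (t * a * r)) := by gcongr
    _ = _ := by rw [mul_left_comm, ← Real.exp_add]; ring_nf

end hilleYosida

/-! ### Limits of semigroups with bounded generators. -/

section hilleYosida

variable {X : Type*} [NormedAddCommGroup X] [NormedSpace ℂ X]

theorem tendsto_of_dense_of_norm_le {L : ℕ → X →L[ℂ] X} {L' : X →L[ℂ] X} {C : ℝ} {D : Set X}
    (hD : Dense D) (hL : ∀ n, ‖L n‖ ≤ C)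
    (h : ∀ x ∈ D, Tendsto (fun n => L n x) atTop (𝓝 (L' x))) (x : X) :
    Tendsto (fun n => L n x) atTop (𝓝 (L' x)) := by
  have hC : 0 ≤ C := (norm_nonneg _).trans (hL 0)
  rw [Metric.tendsto_atTop]
  intro ε hε
  have hp : 0 < C + ‖L'‖ + 1 := by positivity
  obtain ⟨y, hy, hxy⟩ := Metric.dense_iff.mp hD x (ε / 2 / (C + ‖L'‖ + 1)) (by positivity)
  rw [Metric.mem_ball, dist_comm, dist_eq_norm, lt_div_iff₀ hp] at hy
  obtain ⟨N, hN⟩ := Metric.tendsto_atTop.mp (h y hxy) (ε / 2) (by positivity)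
  refine ⟨N, fun n hn => ?_⟩
  have e : L n x - L' x = L n (x - y) - L' (x - y) + (L n y - L' y) := by
    simp only [map_sub]; abel
  have a1 := ContinuousLinearMap.le_of_opNorm_le _ (hL n) (x - y)
  have a2 := L'.le_opNorm (x - y)
  have a3 := hN n hn
  rw [dist_eq_norm] at a3 ⊢
  rw [e]
  have a4 := norm_add_le (L n (x - y) - L' (x - y)) (L n y - L' y)
  have a5 := norm_sub_le (L n (x - y)) (L' (x - y))
  nlinarith [norm_nonneg (x - y)]

theorem cauchySeq_of_dense_of_norm_le {L : ℕ → X →L[ℂ] X} {C : ℝ} {D : Set X}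
    (hD : Dense D) (hL : ∀ n, ‖L n‖ ≤ C)
    (h : ∀ x ∈ D, CauchySeq (fun n => L n x)) (x : X) : CauchySeq (fun n => L n x) := by
  have hC : 0 ≤ C := (norm_nonneg _).trans (hL 0)
  rw [Metric.cauchySeq_iff]
  intro ε hε
  obtain ⟨y, hy, hxy⟩ := Metric.dense_iff.mp hD x (ε / 2 / (2 * C + 1)) (by positivity)
  rw [Metric.mem_ball, dist_comm, dist_eq_norm, lt_div_iff₀ (by positivity)] at hy
  obtain ⟨N, hN⟩ := Metric.cauchySeq_iff.mp (h y hxy) (ε / 2) (by positivity)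
  refine ⟨N, fun m hm n hn => ?_⟩
  have e : L m x - L n x = L m (x - y) - L n (x - y) + (L m y - L n y) := by
    simp only [map_sub]; abel
  have a1 := ContinuousLinearMap.le_of_opNorm_le _ (hL m) (x - y)
  have a2 := ContinuousLinearMap.le_of_opNorm_le _ (hL n) (x - y)
  have a3 := hN m hm n hn
  rw [dist_eq_norm] at a3 ⊢
  rw [e]
  have a4 := norm_add_le (L m (x - y) - L n (x - y)) (L m y - L n y)
  have a5 := norm_sub_le (L m (x - y)) (L n (x - y))
  nlinarith [norm_nonneg (x - y)]

theorem tendsto_apply_of_norm_le {L : ℕ → X →L[ℂ] X} {L' : X →L[ℂ] X} {C : ℝ}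
    (hL : ∀ n, ‖L n‖ ≤ C) {u : ℕ → X} {x : X} (hx : Tendsto (fun n => L n x) atTop (𝓝 (L' x)))
    (hu : Tendsto u atTop (𝓝 x)) : Tendsto (fun n => L n (u n)) atTop (𝓝 (L' x)) := by
  have h1 : Tendsto (fun n => C * ‖u n - x‖) atTop (𝓝 0) := by
    simpa using (tendsto_iff_norm_sub_tendsto_zero.mp hu).const_mul C
  have h2 : Tendsto (fun n => L n (u n - x)) atTop (𝓝 0) :=
    squeeze_zero_norm (fun n => ContinuousLinearMap.le_of_opNorm_le _ (hL n) _) h1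
  simpa using h2.add hx

/-- Bounded operators `P n` that approximate the operator with graph `G` and generate uniformly
bounded semigroups. -/
structure GeneratorApprox (G : Set (X × X)) (K : ℝ → ℝ) (P : ℕ → X →L[ℂ] X) : Prop where
  commute : ∀ m n, Commute (P m) (P n)
  norm_le : ∀ n s t, 0 ≤ s → s ≤ t → ‖expGroup (P n) s‖ ≤ K t
  tendsto : ∀ x y, (x, y) ∈ G → Tendsto (fun n => P n x) atTop (𝓝 y)
  dense : Dense (Prod.fst '' G)

namespace GeneratorApprox

variable {G : Set (X × X)} {K : ℝ → ℝ} {P : ℕ → X →L[ℂ] X} {T : ℝ → X →L[ℂ] X}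

theorem limit_zero (hT : ∀ t, 0 ≤ t → ∀ x, Tendsto (fun n => expGroup (P n) t x) atTop (𝓝 (T t x))) :
    T 0 = 1 := by
  ext x
  have h1 := hT 0 le_rfl x
  simp only [expGroup_zero] at h1
  exact tendsto_nhds_unique h1 tendsto_const_nhds

theorem commute_limit {L : X →L[ℂ] X} (hL : ∀ n, Commute L (P n))
    (hT : ∀ t, 0 ≤ t → ∀ x, Tendsto (fun n => expGroup (P n) t x) atTop (𝓝 (T t x)))
    {t : ℝ} (ht : 0 ≤ t) : Commute L (T t) := by
  ext x
  have h1 := (L.continuous.tendsto _).comp (hT t ht x)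
  have h2 := hT t ht (L x)
  refine tendsto_nhds_unique h1 (h2.congr fun n => ?_)
  exact (apply_comm_of_commute (commute_expGroup (hL n) t) x).symm

variable [CompleteSpace X]

theorem exists_semigroup (hP : GeneratorApprox G K P) :
    ∃ T : ℝ → X →L[ℂ] X, ∀ t, 0 ≤ t → ∀ x,
      Tendsto (fun n => expGroup (P n) t x) atTop (𝓝 (T t x)) := by
  have h1 : ∀ t, ∃ L : X →L[ℂ] X, 0 ≤ t → ∀ x,
      Tendsto (fun n => expGroup (P n) t x) atTop (𝓝 (L x)) := by
    intro t
    by_cases ht : 0 ≤ t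
    swap
    -- Negative times carry no information; the value there is arbitrary.
    · exact ⟨0, fun h => absurd h ht⟩
    have hc : ∀ x, CauchySeq (fun n => expGroup (P n) t x) := by
      refine cauchySeq_of_dense_of_norm_le hP.dense (fun n => hP.norm_le n t t ht le_rfl) ?_
      rintro _ ⟨⟨x, y⟩, hxy, rfl⟩
      have hK : 0 ≤ K t := (norm_nonneg _).trans (hP.norm_le 0 t t ht le_rfl)
      have h2 := (hP.tendsto x y hxy).cauchySeq
      rw [Metric.cauchySeq_iff] at h2 ⊢
      intro ε hε
      obtain ⟨N, hN⟩ := h2 (ε / (K t * K t * t + 1)) (by positivity)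
      refine ⟨N, fun m hm n hn => ?_⟩
      have h3 := hN m hm n hn
      rw [dist_eq_norm, lt_div_iff₀ (by positivity)] at h3
      rw [dist_eq_norm]
      have h4 := norm_expGroup_sub_expGroup_le (hP.commute m n) ht
        (fun s h1 h2 => hP.norm_le m s t h1 h2) (fun s h1 h2 => hP.norm_le n s t h1 h2) x
      dsimp only
      nlinarith [norm_nonneg (P m x - P n x)]
    choose f hf using fun x => cauchySeq_tendsto_of_complete (hc x)
    -- Banach–Steinhaus makes the pointwise limit a bounded operator.
    exact ⟨continuousLinearMapOfTendsto _ (tendsto_pi_nhds.mpr hf), fun _ => hf⟩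
  choose T hT using h1
  exact ⟨T, hT⟩

theorem limit_add (hP : GeneratorApprox G K P)
    (hT : ∀ t, 0 ≤ t → ∀ x, Tendsto (fun n => expGroup (P n) t x) atTop (𝓝 (T t x)))
    {s t : ℝ} (hs : 0 ≤ s) (ht : 0 ≤ t) : T (s + t) = T s * T t := by
  ext x
  have h1 := hT (s + t) (add_nonneg hs ht) x
  simp only [expGroup_add] at h1
  have h2 : Tendsto (fun n => expGroup (P n) s (expGroup (P n) t x)) atTop (𝓝 (T s (T t x))) :=
    tendsto_apply_of_norm_le (fun n => hP.norm_le n s s hs le_rfl) (hT s hs _) (hT t ht x)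
  exact tendsto_nhds_unique h1 h2

theorem norm_limit_sub_le (hP : GeneratorApprox G K P)
    (hT : ∀ t, 0 ≤ t → ∀ x, Tendsto (fun n => expGroup (P n) t x) atTop (𝓝 (T t x)))
    {x y : X} (hxy : (x, y) ∈ G) {t r : ℝ} (ht : 0 ≤ t) (htr : t ≤ r) :
    ‖T t x - x‖ ≤ K r * ‖y‖ * t :=
  le_of_tendsto_of_tendsto' ((hT t ht x).sub_const x).norm
    (((hP.tendsto x y hxy).norm.const_mul (K r)).mul_const t)
    fun n => norm_expGroup_sub_le ht (fun s h1 h2 => hP.norm_le n s r h1 (h2.trans htr)) x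

theorem norm_limit_sub_sub_smul_le (hP : GeneratorApprox G K P)
    (hT : ∀ t, 0 ≤ t → ∀ x, Tendsto (fun n => expGroup (P n) t x) atTop (𝓝 (T t x)))
    {x y z z' : X} (hxy : (x, y) ∈ G) (hz : (z, z') ∈ G) {t r : ℝ} (ht : 0 ≤ t) (htr : t ≤ r) :
    ‖T t x - x - t • y‖ ≤ ((K r + 1) * ‖y - z‖ + K r * ‖z'‖ * t) * t := by
  have h1 : Tendsto (fun n => K r * ‖P n x - y‖) atTop (𝓝 0) := by
    simpa using (tendsto_iff_norm_sub_tendsto_zero.mp (hP.tendsto x y hxy)).const_mul (K r)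
  have h2 := ((h1.add_const ((K r + 1) * ‖y - z‖)).add
    (((hP.tendsto z z' hz).norm.const_mul (K r)).mul_const t)).mul_const t
  rw [zero_add] at h2
  exact le_of_tendsto_of_tendsto' (((hT t ht x).sub_const x).sub_const (t • y)).norm h2
    fun n => norm_expGroup_sub_sub_smul_le ht
      (fun s h1 h2 => hP.norm_le n s r h1 (h2.trans htr)) x y z

theorem limit_mul_limit_eq_one {Q : ℕ → X →L[ℂ] X} {S : ℝ → X →L[ℂ] X}
    (hP : GeneratorApprox G K P) (hQ : GeneratorApprox {p | (p.1, -p.2) ∈ G} K Q)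
    (hPQ : ∀ n, Commute (P n) (Q n))
    (hT : ∀ t, 0 ≤ t → ∀ x, Tendsto (fun n => expGroup (P n) t x) atTop (𝓝 (T t x)))
    (hS : ∀ t, 0 ≤ t → ∀ x, Tendsto (fun n => expGroup (Q n) t x) atTop (𝓝 (S t x)))
    {t : ℝ} (ht : 0 ≤ t) : T t * S t = 1 := by
  apply ContinuousLinearMap.coeFn_injective
  refine Continuous.ext_on hP.dense (T t * S t).continuous (1 : X →L[ℂ] X).continuous ?_
  rintro _ ⟨⟨x, y⟩, hxy, rfl⟩
  have h1 : Tendsto (fun n => expGroup (P n) t (expGroup (Q n) t x)) atTop (𝓝 (T t (S t x))) :=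
    tendsto_apply_of_norm_le (fun n => hP.norm_le n t t ht le_rfl) (hT t ht _) (hS t ht x)
  have h2 : Tendsto (fun n => K t * (K t * ‖P n x + Q n x‖) * t) atTop (𝓝 0) := by
    have h3 := ((hP.tendsto x y hxy).add (hQ.tendsto x (-y) (by simpa using hxy))).norm
    simpa using ((h3.const_mul (K t)).const_mul (K t)).mul_const t
  have h3 : Tendsto (fun n => expGroup (P n) t (expGroup (Q n) t x) - x) atTop (𝓝 0) :=
    squeeze_zero_norm (fun n => norm_expGroup_mul_sub_le (hPQ n) ht
      (fun s h1 h2 => hP.norm_le n s t h1 h2) (fun s h1 h2 => hQ.norm_le n s t h1 h2) x) h2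
  have h4 := tendsto_nhds_unique (h1.sub_const x) h3
  exact sub_eq_zero.mp h4

end GeneratorApprox

end hilleYosida

/-! ### Groups from two semigroups, and resolvent families. -/

section hilleYosida

variable {X : Type*} [NormedAddCommGroup X] [NormedSpace ℂ X]

/-- Two mutually inverse `C₀`-semigroups `T`, `S` give a `C₀`-group. -/
def C0Group.ofSemigroups (T S : ℝ → X →L[ℂ] X) (hT0 : T 0 = 1) (hS0 : S 0 = 1)
    (hT : ∀ s t, 0 ≤ s → 0 ≤ t → T (s + t) = T s * T t)
    (hS : ∀ s t, 0 ≤ s → 0 ≤ t → S (s + t) = S s * S t)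
    (hTS : ∀ s t, 0 ≤ s → 0 ≤ t → Commute (T s) (S t))
    (h1 : ∀ t, 0 ≤ t → T t * S t = 1)
    (hTc : ∀ x, Tendsto (fun t => T t x) (𝓝[≥] 0) (𝓝 x))
    (hSc : ∀ x, Tendsto (fun t => S t x) (𝓝[≥] 0) (𝓝 x)) : C0Group X :=
  have hadd : ∀ s t, T (max (s + t) 0) * S (max (-(s + t)) 0) =
      T (max s 0) * S (max (-s) 0) * (T (max t 0) * S (max (-t) 0)) := fun s t => by
    -- T p S q depends only on p − q, because T r S r = 1 can be inserted or removed.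
    have key : ∀ p q a b, 0 ≤ p → 0 ≤ q → 0 ≤ a → 0 ≤ b → p + b = a + q →
        T p * S q = T a * S b := by
      intro p q a b hp hq ha hb h
      calc T p * S q = T p * (T b * S b) * S q := by rw [h1 b hb, mul_one]
        _ = T (p + b) * S (b + q) := by rw [hT p b hp hb, hS b q hb hq]; simp only [mul_assoc]
        _ = T (a + q) * S (q + b) := by rw [h, add_comm b q]
        _ = T a * (T q * S q) * S b := by rw [hT a q ha hq, hS q b hq hb]; simp only [mul_assoc]
        _ = T a * S b := by rw [h1 q hq, mul_one]
    have hm : ∀ r : ℝ, 0 ≤ max r 0 := fun r => le_max_right _ _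
    have hr : ∀ r : ℝ, max r 0 - max (-r) 0 = r := fun r => max_zero_sub_max_neg_zero_eq_self r
    rw [mul_assoc, ← mul_assoc (S (max (-s) 0)), ← (hTS _ _ (hm t) (hm (-s))).eq, mul_assoc,
      ← mul_assoc, ← hT _ _ (hm s) (hm t), ← hS _ _ (hm (-s)) (hm (-t))]
    exact key _ _ _ _ (hm _) (hm _) (add_nonneg (hm _) (hm _)) (add_nonneg (hm _) (hm _))
      (by linarith [hr (s + t), hr s, hr t])
  { op := fun t => T (max t 0) * S (max (-t) 0)
    op_zero := by simp [hT0, hS0]; rfl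
    op_add := hadd
    continuous_op := fun x => by
      have hm : Tendsto (fun r : ℝ => max r 0) (𝓝 0) (𝓝[≥] 0) :=
        tendsto_nhdsWithin_iff.mpr ⟨by
          simpa using (continuous_id.max (continuous_const (y := (0 : ℝ)))).tendsto (0 : ℝ),
          .of_forall fun r => Set.mem_Ici.mpr (le_max_right _ _)⟩
      have hm' : Tendsto (fun r : ℝ => max (-r) 0) (𝓝 0) (𝓝[≥] 0) :=
        hm.comp (by simpa using (continuous_neg (G := ℝ)).tendsto 0)
      have h0 : Tendsto (fun t => (T (max t 0) * S (max (-t) 0)) x) (𝓝 0) (𝓝 x) := by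
        -- One of the two factors is the identity for every t, so no local bound on T is needed for
        -- continuity at 0.
        have e : ∀ t, (T (max t 0) * S (max (-t) 0)) x
            = T (max t 0) x + (S (max (-t) 0) x - x) := fun t => by
          rcases le_total 0 t with ht | ht
          · rw [max_eq_right (neg_nonpos.mpr ht), hS0]; simp
          · rw [max_eq_right ht, hT0]; simp
        simp only [e]
        simpa using ((hTc x).comp hm).add (((hSc x).comp hm').sub_const x)
      rw [continuous_iff_continuousAt]
      intro t
      have h2 := (((T (max t 0) * S (max (-t) 0)).continuous.tendsto x).comp h0).comp
        (by simpa using (continuous_sub_right t).tendsto t : Tendsto (fun s => s - t) (𝓝 t) (𝓝 0))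
      refine h2.congr fun s => ?_
      simp only [Function.comp_apply]
      rw [← mul_apply_eq_comp, ← hadd, add_sub_cancel] }

/-- The Yosida approximation. -/
def yosida (R : ℝ → X →L[ℂ] X) (l : ℝ) : X →L[ℂ] X := l ^ 2 • R l - l • 1

theorem commute_yosida {R : ℝ → X →L[ℂ] X} {L : X →L[ℂ] X} {l : ℝ} (h : Commute L (R l)) :
    Commute L (yosida R l) :=
  (h.smul_right _).sub_right ((Commute.one_right _).smul_right _)

/-- `R l` is the inverse of `l - G` for the real `l` with `|l| > ω`, and the powers of `R l` satisfy
the Hille-Yosida estimate. -/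
structure IsResolventFamily (G : Set (X × X)) (R : ℝ → X →L[ℂ] X) (ω M : ℝ) : Prop where
  nonneg : 0 ≤ ω
  left_inv : ∀ l, ω < |l| → ∀ x y, (x, y) ∈ G → R l (l • x - y) = x
  right_inv : ∀ l, ω < |l| → ∀ w, (R l w, l • R l w - w) ∈ G
  norm_pow_le : ∀ l, ω < |l| → ∀ n, ‖R l ^ n‖ ≤ M * (1 / (|l| - ω)) ^ n
  dense : Dense (Prod.fst '' G)

namespace IsResolventFamily

variable {G : Set (X × X)} {R : ℝ → X →L[ℂ] X} {ω M : ℝ}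

/-- With A the operator whose graph is G, l − (−A) = −((−l) − A); the condition on |l| is symmetric,
so one family serves both semigroups. -/
theorem neg (hR : IsResolventFamily G R ω M) :
    IsResolventFamily {p | (p.1, -p.2) ∈ G} (fun l => -R (-l)) ω M where
  nonneg := hR.nonneg
  left_inv l hl x y hxy := by
    have := hR.left_inv (-l) (by rwa [abs_neg]) x (-y) hxy
    rw [neg_apply, ← map_neg]
    convert this using 2
    rw [neg_smul]; abel
  right_inv l hl w := by
    have := hR.right_inv (-l) (by rwa [abs_neg]) (-w)
    rw [map_neg] at this
    change (_, _) ∈ G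
    have e : -(l • (-R (-l)) w - w) = -l • -R (-l) w - -w := by
      simp only [neg_apply, smul_neg, neg_smul]; abel
    rw [e]
    exact this
  norm_pow_le l hl n := by
    have := hR.norm_pow_le (-l) (by rwa [abs_neg]) n
    rw [abs_neg] at this
    rwa [norm_neg_pow]
  dense := by
    refine hR.dense.mono ?_
    rintro _ ⟨⟨x, y⟩, hxy, rfl⟩
    exact ⟨(x, -y), by simpa using hxy, rfl⟩

/-- The resolvent identity: R l is applied to (l − A)R m w = w − (m − l)R m w, A being the operator
with graph G. Its symmetry in l and m makes the resolvents commute. -/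
theorem sub_smul_mul (hR : IsResolventFamily G R ω M) {l m : ℝ} (hl : ω < |l|) (hm : ω < |m|) :
    (m - l) • (R l * R m) = R l - R m := by
  ext w
  have h1 := hR.left_inv l hl _ _ (hR.right_inv m hm w)
  have h2 : l • R m w - (m • R m w - w) = w - (m - l) • R m w := by rw [sub_smul]; abel
  rw [h2, map_sub, ContinuousLinearMap.map_smul_of_tower] at h1
  simp only [smul_apply, sub_apply, mul_apply_eq_comp]
  rw [sub_eq_iff_eq_add] at h1
  rw [h1]
  abel

theorem commute (hR : IsResolventFamily G R ω M) {l m : ℝ} (hl : ω < |l|) (hm : ω < |m|) :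
    Commute (R l) (R m) := by
  rcases eq_or_ne l m with rfl | hlm
  · exact Commute.refl _
  · have h1 := hR.sub_smul_mul hl hm
    have h2 := hR.sub_smul_mul hm hl
    rw [← neg_sub m l, neg_smul, neg_eq_iff_eq_neg, neg_sub, ← h1] at h2
    exact smul_right_injective _ (sub_ne_zero.mpr hlm.symm) h2.symm

/-- On the domain of the operator A with graph G, l R l x − x = R l (Ax) = O(1/l), and the operators
l R l are uniformly bounded. The parameter l = n + 2ω + 1 satisfies l > ω and l ≤ 2(l − ω), which
produces the bound 2M. -/
theorem tendsto_smul_apply (hR : IsResolventFamily G R ω M) (x : X) :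
    Tendsto (fun n : ℕ => (n + (2 * ω + 1)) • R (n + (2 * ω + 1)) x) atTop (𝓝 x) := by
  have hω := hR.nonneg
  have hl : ∀ n : ℕ, 0 ≤ (n : ℝ) := fun n => n.cast_nonneg
  have hab : ∀ n : ℕ, |(n + (2 * ω + 1) : ℝ)| = n + (2 * ω + 1) := fun n =>
    abs_of_nonneg (by linarith [hl n])
  have hlt : ∀ n : ℕ, ω < |(n + (2 * ω + 1) : ℝ)| := fun n => by rw [hab]; linarith [hl n]
  have hM : 0 ≤ M := by simpa using (norm_nonneg _).trans (hR.norm_pow_le _ (hlt 0) 0)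
  have hn : ∀ n : ℕ, ‖R (n + (2 * ω + 1))‖ ≤ M / (n + (ω + 1)) := fun n => by
    have := hR.norm_pow_le _ (hlt n) 1
    rw [pow_one, pow_one, hab, mul_one_div] at this
    convert this using 2; ring
  refine tendsto_of_dense_of_norm_le (L' := 1) (C := 2 * M)
    (L := fun n => ((n : ℝ) + (2 * ω + 1)) • R (n + (2 * ω + 1))) hR.dense ?_ ?_ x
  · intro n
    rw [norm_smul, Real.norm_eq_abs, hab]
    calc (n + (2 * ω + 1)) * ‖R (n + (2 * ω + 1))‖
        ≤ (n + (2 * ω + 1)) * (M / (n + (ω + 1))) := by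
          exact mul_le_mul_of_nonneg_left (hn n) (by linarith [hl n])
      _ ≤ 2 * M := by
          have hp : 0 < n + (ω + 1) := by linarith [hl n]
          rw [mul_div_assoc', div_le_iff₀ hp]
          nlinarith [mul_nonneg hM (hl n)]
  · rintro _ ⟨⟨x, y⟩, hxy, rfl⟩
    have e : ∀ n : ℕ, R (n + (2 * ω + 1)) y
        = ((n : ℝ) + (2 * ω + 1)) • R (n + (2 * ω + 1)) x - x := fun n => by
      have := hR.left_inv _ (hlt n) x y hxy
      rw [map_sub, ContinuousLinearMap.map_smul_of_tower] at this
      rw [sub_eq_iff_eq_add] at this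
      rw [this]
      abel
    have h1 : Tendsto (fun n : ℕ => M / (n + (ω + 1)) * ‖y‖) atTop (𝓝 0) := by
      have h2 := tendsto_const_nhds (x := M).div_atTop
        (tendsto_atTop_add_const_right atTop (ω + 1) (tendsto_natCast_atTop_atTop (R := ℝ)))
      simpa using h2.mul_const ‖y‖
    have h2 : Tendsto (fun n : ℕ => R (n + (2 * ω + 1)) y) atTop (𝓝 0) :=
      squeeze_zero_norm (fun n => ContinuousLinearMap.le_of_opNorm_le _ (hn n) y) h1
    simp only [e] at h2
    simpa using h2.add_const x

end IsResolventFamily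

variable [CompleteSpace X]

/-! ### Continuity and differentiability at 0 of the limit semigroup, and the resulting group. -/

namespace GeneratorApprox

variable {G : Set (X × X)} {K : ℝ → ℝ} {P Q : ℕ → X →L[ℂ] X} {T : ℝ → X →L[ℂ] X}

theorem tendsto_limit (hP : GeneratorApprox G K P)
    (hT : ∀ t, 0 ≤ t → ∀ x, Tendsto (fun n => expGroup (P n) t x) atTop (𝓝 (T t x))) (x : X) :
    Tendsto (fun t => T t x) (𝓝[≥] 0) (𝓝 x) := by
  have hb : ∀ t, 0 ≤ t → t ≤ 1 → ∀ z, ‖T t z‖ ≤ K 1 * ‖z‖ := fun t ht ht1 z =>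
    le_of_tendsto' (hT t ht z).norm fun n =>
      ContinuousLinearMap.le_of_opNorm_le _ (hP.norm_le n t 1 ht ht1) z
  have hK : 0 ≤ K 1 := (norm_nonneg _).trans (hP.norm_le 0 1 1 zero_le_one le_rfl)
  rw [Metric.tendsto_nhdsWithin_nhds]
  intro ε hε
  obtain ⟨y, hy, ⟨⟨y, y'⟩, hyG, rfl⟩⟩ := Metric.dense_iff.mp hP.dense x (ε / 2 / (K 1 + 1))
    (by positivity)
  rw [Metric.mem_ball, dist_comm, dist_eq_norm, lt_div_iff₀ (by positivity)] at hy
  refine ⟨min 1 (ε / 2 / (K 1 * ‖y'‖ + 1)), by positivity, fun {t} ht htd => ?_⟩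
  have ht : 0 ≤ t := ht
  rw [dist_zero_right, Real.norm_eq_abs, abs_of_nonneg ht, lt_min_iff,
    lt_div_iff₀ (by positivity)] at htd
  have a1 := hb t ht htd.1.le (x - y)
  have a2 := hP.norm_limit_sub_le hT hyG ht htd.1.le
  have e : T t x - x = T t (x - y) - (x - y) + (T t y - y) := by rw [map_sub]; abel
  rw [dist_eq_norm, e]
  have a3 := norm_add_le (T t (x - y) - (x - y)) (T t y - y)
  have a4 := norm_sub_le (T t (x - y)) (x - y)
  dsimp only at hy
  nlinarith [norm_nonneg (x - y)]

theorem eventually_norm_limit_le (hP : GeneratorApprox G K P)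
    (hT : ∀ t, 0 ≤ t → ∀ x, Tendsto (fun n => expGroup (P n) t x) atTop (𝓝 (T t x)))
    {x y : X} (hxy : (x, y) ∈ G) {ε : ℝ} (hε : 0 < ε) :
    ∃ δ > 0, ∀ t, 0 ≤ t → t < δ → ‖T t x - x - t • y‖ ≤ ε * t := by
  have hK : 0 ≤ K 1 := (norm_nonneg _).trans (hP.norm_le 0 1 1 zero_le_one le_rfl)
  obtain ⟨z, hy, ⟨⟨z, z'⟩, hz, rfl⟩⟩ := Metric.dense_iff.mp hP.dense y (ε / 2 / (K 1 + 1))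
    (by positivity)
  rw [Metric.mem_ball, dist_comm, dist_eq_norm, lt_div_iff₀ (by positivity)] at hy
  refine ⟨min 1 (ε / 2 / (K 1 * ‖z'‖ + 1)), by positivity, fun t ht htd => ?_⟩
  rw [lt_min_iff, lt_div_iff₀ (by positivity)] at htd
  refine (hP.norm_limit_sub_sub_smul_le hT hxy hz ht htd.1.le).trans ?_
  dsimp only at hy
  gcongr
  nlinarith

/-- Only one inclusion between G and the generator comes from the approximation. The commutation
clause is recorded for the converse, where L is a resolvent. -/
theorem exists_c0Group (hP : GeneratorApprox G K P)
    (hQ : GeneratorApprox {p | (p.1, -p.2) ∈ G} K Q) (hPQ : ∀ m n, Commute (P m) (Q n)) :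
    ∃ W : C0Group X, (∀ x y, (x, y) ∈ G → HasDerivAt (fun t => W.op t x) y 0) ∧
      ∀ L : X →L[ℂ] X, (∀ n, Commute L (P n)) → (∀ n, Commute L (Q n)) →
        ∀ t, Commute L (W.op t) := by
  obtain ⟨T, hT⟩ := hP.exists_semigroup
  obtain ⟨S, hS⟩ := hQ.exists_semigroup
  have hT0 := limit_zero hT
  have hS0 := limit_zero hS
  let W := C0Group.ofSemigroups T S hT0 hS0
    (fun s t hs ht => hP.limit_add hT hs ht) (fun s t hs ht => hQ.limit_add hS hs ht)
    (fun s t hs ht => commute_limit (fun n => (commute_limit (fun m => (hPQ m n).symm) hT hs).symm)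
      hS ht)
    (fun t ht => hP.limit_mul_limit_eq_one hQ (fun n => hPQ n n) hT hS ht)
    (hP.tendsto_limit hT) (hQ.tendsto_limit hS)
  have hW : ∀ t, W.op t = T (max t 0) * S (max (-t) 0) := fun t => rfl
  refine ⟨W, fun x y hxy => ?_, fun L h1 h2 t => ?_⟩
  · rw [hasDerivAt_iff_isLittleO, Asymptotics.isLittleO_iff]
    intro ε hε
    obtain ⟨δ, hδ, h1⟩ := hP.eventually_norm_limit_le hT hxy hε
    obtain ⟨δ', hδ', h2⟩ := hQ.eventually_norm_limit_le (y := -y) hS (by simpa using hxy) hε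
    filter_upwards [Metric.ball_mem_nhds (0 : ℝ) (lt_min hδ hδ')] with t ht
    rw [mem_ball_zero_iff, Real.norm_eq_abs, lt_min_iff] at ht
    rw [W.op_zero, ContinuousLinearMap.id_apply, sub_zero, Real.norm_eq_abs, hW]
    rcases le_total 0 t with h0 | h0
    · rw [max_eq_right (neg_nonpos.mpr h0), max_eq_left h0, hS0, mul_one, abs_of_nonneg h0]
      exact h1 t h0 (by rw [← abs_of_nonneg h0]; exact ht.1)
    · rw [max_eq_right h0, max_eq_left (neg_nonneg.mpr h0), hT0, one_mul, abs_of_nonpos h0]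
      simpa using h2 (-t) (neg_nonneg.mpr h0) (by rw [← abs_of_nonpos h0]; exact ht.2)
  · rw [hW]
    exact (commute_limit h1 hT (le_max_right _ _)).mul_right
      (commute_limit h2 hS (le_max_right _ _))

end GeneratorApprox

namespace IsResolventFamily

variable {G : Set (X × X)} {R : ℝ → X →L[ℂ] X} {ω M : ℝ}

theorem generatorApprox (hR : IsResolventFamily G R ω M) :
    GeneratorApprox G (fun t => M * Real.exp (2 * ω * t))
      (fun n : ℕ => yosida R (n + (2 * ω + 1))) := by
  have hω := hR.nonneg
  have hl : ∀ n : ℕ, 0 ≤ (n : ℝ) := fun n => n.cast_nonneg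
  have hab : ∀ n : ℕ, |(n + (2 * ω + 1) : ℝ)| = n + (2 * ω + 1) := fun n =>
    abs_of_nonneg (by linarith [hl n])
  have hlt : ∀ n : ℕ, ω < |(n + (2 * ω + 1) : ℝ)| := fun n => by rw [hab]; linarith [hl n]
  have hM : 0 ≤ M := by simpa using (norm_nonneg _).trans (hR.norm_pow_le _ (hlt 0) 0)
  refine ⟨fun m n => ?_, fun n s t hs hst => ?_, fun x y hxy => ?_, hR.dense⟩
  · exact commute_yosida (commute_yosida (hR.commute (hlt n) (hlt m))).symm
  · have h1 := hR.norm_pow_le _ (hlt n)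
    have hp : 0 < |(n + (2 * ω + 1) : ℝ)| - ω := by linarith [hlt n]
    refine (norm_expGroup_smul_sub_le hs (sq_nonneg _) h1 _).trans ?_
    -- l²/(l − ω) − l = lω/(l − ω), and this is at most 2ω as soon as l ≥ 2ω, which the shift by 2ω
    -- + 1 ensures.
    have h2 : (n + (2 * ω + 1) : ℝ) ^ 2 * (1 / (|(n + (2 * ω + 1) : ℝ)| - ω)) - (n + (2 * ω + 1))
        ≤ 2 * ω := by
      rw [hab] at hp ⊢
      rw [mul_one_div, sub_le_iff_le_add, div_le_iff₀ hp]
      nlinarith [hl n, mul_nonneg hω (hl n)]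
    refine mul_le_mul_of_nonneg_left (Real.exp_le_exp.mpr ?_) hM
    exact (mul_le_mul_of_nonneg_left h2 hs).trans (by nlinarith)
  -- For (x, y) in G the Yosida approximation of x equals l R l y.
  · refine (hR.tendsto_smul_apply y).congr fun n => ?_
    have := hR.left_inv _ (hlt n) x y hxy
    rw [map_sub, ContinuousLinearMap.map_smul_of_tower, sub_eq_iff_eq_add'] at this
    simp only [yosida, sub_apply, smul_apply, one_apply_eq_self, sq, mul_smul]
    rw [← smul_sub, this]
    simp

/-- The Hille-Yosida theorem for groups. -/
theorem exists_c0Group (hR : IsResolventFamily G R ω M) :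
    ∃ W : C0Group X, ∀ x y, HasDerivAt (fun t => W.op t x) y 0 ↔ (x, y) ∈ G := by
  have hω := hR.nonneg
  have hl : ∀ n : ℕ, 0 ≤ (n : ℝ) := fun n => n.cast_nonneg
  have hab : ∀ n : ℕ, |(n + (2 * ω + 1) : ℝ)| = n + (2 * ω + 1) := fun n =>
    abs_of_nonneg (by linarith [hl n])
  have hlt : ∀ n : ℕ, ω < |(n + (2 * ω + 1) : ℝ)| := fun n => by rw [hab]; linarith [hl n]
  have hlt' : ∀ n : ℕ, ω < |-(n + (2 * ω + 1) : ℝ)| := fun n => by rw [abs_neg]; exact hlt n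
  obtain ⟨W, h1, h2⟩ := hR.generatorApprox.exists_c0Group hR.neg.generatorApprox
    (fun m n => commute_yosida
      (commute_yosida (hR.commute (hlt' n) (hlt m)).neg_left).symm)
  refine ⟨W, fun x y => ⟨fun hd => ?_, h1 x y⟩⟩
  -- If W t x has derivative y at 0, the derivative of W t (R l x) can be computed in two ways: R l
  -- y, as R l commutes with W t, and l R l x − x, as R l x lies in the domain. Hence x = R l (l x −
  -- y), which is in the domain.
  have h3 := h2 (R ((0 : ℕ) + (2 * ω + 1)))
    (fun n => commute_yosida (hR.commute (hlt 0) (hlt n)))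
    (fun n => commute_yosida (hR.commute (hlt 0) (hlt' n)).neg_right)
  set l : ℝ := (0 : ℕ) + (2 * ω + 1)
  have h4 := h1 _ _ (hR.right_inv l (hlt 0) x)
  have h5 : HasDerivAt (fun t => W.op t (R l x)) (R l y) 0 := by
    have := ((R l).restrictScalars ℝ).hasFDerivAt.comp_hasDerivAt (0 : ℝ) hd
    exact this.congr_of_eventuallyEq (.of_forall fun t => (apply_comm_of_commute (h3 t) x).symm)
  have h6 := h4.unique h5
  have h7 : R l (l • x - y) = x := by rw [map_sub, ContinuousLinearMap.map_smul_of_tower, ← h6]; abel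
  have h8 := hR.right_inv l (hlt 0) (l • x - y)
  rw [h7] at h8
  simpa using h8

end IsResolventFamily

end hilleYosida

/-! ### Operators symmetric with respect to a weaker inner product -/

section lax

variable {E F : Type*} [NormedAddCommGroup E] [NormedSpace ℂ E]
  [NormedAddCommGroup F] [InnerProductSpace ℂ F]

/-- Symmetry and Cauchy–Schwarz give ‖iAx‖² ≤ ‖ix‖‖iA²x‖. Iteration along the powers 2ⁿ bounds
(‖iAx‖/‖ix‖)^{2ⁿ} by a constant times ‖A‖^{2ⁿ}; the constant, which involves ‖x‖ in the strong norm,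
disappears as n grows. -/
theorem norm_apply_le_of_symmetric (i : E →L[ℂ] F) {A : E →L[ℂ] E}
    (hA : ∀ x y, inner ℂ (i (A x)) (i y) = inner ℂ (i x) (i (A y))) (x : E) :
    ‖i (A x)‖ ≤ ‖A‖ * ‖i x‖ := by
  have hAn : ∀ n x y, inner ℂ (i ((A ^ n) x)) (i y) = inner ℂ (i x) (i ((A ^ n) y)) := by
    intro n
    induction n with
    | zero => simp
    | succ n ih =>
      intro x y
      rw [pow_succ', mul_apply_eq_comp, hA, ih, ← mul_apply_eq_comp, ← pow_succ, ← pow_succ']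
  have hsq : ∀ n, ‖i ((A ^ n) x)‖ ^ 2 ≤ ‖i x‖ * ‖i ((A ^ (2 * n)) x)‖ := fun n => by
    rw [two_mul, pow_add, mul_apply_eq_comp]
    refine le_trans (le_of_eq ?_) (norm_inner_le_norm (𝕜 := ℂ) (i x) _)
    rw [← hAn, inner_self_eq_norm_sq_to_K, norm_pow, RCLike.norm_ofReal, abs_norm]
  by_contra! hlt
  have hb : 0 < ‖i x‖ := by
    rcases (norm_nonneg (i x)).eq_or_lt with h0 | h0
    · have h1 := hsq 1
      rw [← h0, zero_mul, pow_one] at h1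
      have : ‖i (A x)‖ = 0 := by nlinarith [norm_nonneg (i (A x))]
      rw [← h0, this] at hlt
      simp at hlt
    · exact h0
  have hA0 : 0 < ‖A‖ := by
    rcases (norm_nonneg A).eq_or_lt with h0 | h0
    · rw [norm_eq_zero.mp h0.symm] at hlt
      simp at hlt
    · exact h0
  set q := ‖i (A x)‖ / ‖i x‖ with hq
  have hq0 : 0 ≤ q := by positivity
  have hgrow : ∀ n : ℕ, q ^ 2 ^ n ≤ ‖i ((A ^ 2 ^ n) x)‖ / ‖i x‖ := by
    intro n
    induction n with
    | zero => simp [hq]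
    | succ n ih =>
      calc q ^ 2 ^ (n + 1) = (q ^ 2 ^ n) ^ 2 := by rw [← pow_mul, pow_succ]
        _ ≤ (‖i ((A ^ 2 ^ n) x)‖ / ‖i x‖) ^ 2 := by gcongr
        _ ≤ _ := by
          have := hsq (2 ^ n)
          rw [div_pow, div_le_div_iff₀ (by positivity) hb, pow_succ' 2 n]
          nlinarith
  have hbd : ∀ n : ℕ, (q / ‖A‖) ^ n ≤ ‖i‖ * ‖x‖ / ‖i x‖ := by
    intro n
    have h1 : 1 ≤ q / ‖A‖ := by
      rw [one_le_div hA0, hq, le_div_iff₀ hb]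
      exact hlt.le
    refine (pow_le_pow_right₀ h1 (Nat.lt_two_pow_self (n := n)).le).trans ?_
    rw [div_pow, div_le_iff₀ (by positivity)]
    refine (hgrow n).trans ?_
    rw [div_mul_eq_mul_div]
    gcongr
    calc ‖i ((A ^ 2 ^ n) x)‖ ≤ ‖i‖ * ‖(A ^ 2 ^ n) x‖ := i.le_opNorm _
      _ ≤ ‖i‖ * (‖A‖ ^ 2 ^ n * ‖x‖) := by
        gcongr
        exact ContinuousLinearMap.le_of_opNorm_le _ (norm_pow_le' A (by positivity)) x
      _ = _ := by ring
  have h1 : 1 < q / ‖A‖ := by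
    rw [one_lt_div hA0, hq, lt_div_iff₀ hb]
    exact hlt
  obtain ⟨n, hn⟩ := pow_unbounded_of_one_lt (‖i‖ * ‖x‖ / ‖i x‖) h1
  exact absurd (hbd n) hn.not_ge

/-- A bounded operator with a bounded formal adjoint with respect to a weaker inner product is
bounded for the weaker norm. -/
theorem norm_apply_le_of_formalAdjoint (i : E →L[ℂ] F) {S S' : E →L[ℂ] E}
    (hS : ∀ x y, inner ℂ (i (S x)) (i y) = inner ℂ (i x) (i (S' y))) {a b : ℝ} (ha : 0 ≤ a)
    (hb : 0 ≤ b) (h1 : ‖S‖ ≤ a * b) (h2 : ‖S'‖ ≤ a * b) (x : E) :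
    ‖i (S x)‖ ≤ a * b * ‖i x‖ := by
  -- S'S is symmetric for the weak inner product, and ‖iSx‖² = (ix|iS'Sx).
  have hA : ∀ x y, inner ℂ (i ((S' * S) x)) (i y) = inner ℂ (i x) (i ((S' * S) y)) := fun x y => by
    rw [mul_apply_eq_comp, mul_apply_eq_comp, ← hS, ← inner_conj_symm, ← hS, inner_conj_symm]
  have h3 := norm_apply_le_of_symmetric i hA x
  have h4 : ‖S' * S‖ ≤ (a * b) ^ 2 := by
    rw [sq]
    exact (norm_mul_le _ _).trans (mul_le_mul h2 h1 (norm_nonneg _) (by positivity))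
  have h5 : ‖i (S x)‖ ^ 2 ≤ ‖i x‖ * ‖i ((S' * S) x)‖ := by
    refine le_trans (le_of_eq ?_) (norm_inner_le_norm (𝕜 := ℂ) (i x) _)
    rw [mul_apply_eq_comp, ← hS, inner_self_eq_norm_sq_to_K, norm_pow, RCLike.norm_ofReal, abs_norm]
  refine le_of_sq_le_sq ?_ (by positivity)
  calc ‖i (S x)‖ ^ 2 ≤ ‖i x‖ * ((a * b) ^ 2 * ‖i x‖) := by
        refine h5.trans ?_
        gcongr
        exact h3.trans (by gcongr)
    _ = _ := by ring

end lax

theorem riesz_surjective {E : Type*} [NormedAddCommGroup E] [InnerProductSpace ℂ E]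
    [CompleteSpace E] : Function.Surjective (riesz (E := E)) := by
  intro f
  let φ : E →L[ℂ] ℂ := ((starL ℂ : ℂ ≃L⋆[ℂ] ℂ) : ℂ →L⋆[ℂ] ℂ).comp f
  refine ⟨(InnerProductSpace.toDual ℂ E).symm φ, ?_⟩
  ext x
  change inner ℂ x _ = f x
  rw [← inner_conj_symm, InnerProductSpace.toDual_symm_apply]
  exact star_star (f x)

section kleinGordon

variable {H : Type*} [NormedAddCommGroup H] [InnerProductSpace ℂ H] [CompleteSpace H]
variable {h : H →ₗ.[ℂ] H}

/-! ### The form of `h` -/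

/-- Applying h twice to ⟨h⟩⁻²z gives z − ⟨h⟩⁻²z, and h is single-valued. With T = h⟨h⟩⁻¹ and J =
⟨h⟩⁻¹ it yields ‖x‖² = ‖Tx‖² + ‖Jx‖². -/
theorem boundedTransform_boundedTransform (hsa : IsSelfAdjoint h) (z : H) :
    boundedTransform hsa (boundedTransform hsa z) = z - japPow hsa 1 (japPow hsa 1 z) := by
  obtain ⟨v, h1, h2⟩ := japInvSq_spec hsa z
  have h3 := boundedTransform_spec hsa (japPow hsa 1 z)
  have hJ : japPow hsa 1 (japPow hsa 1 z) = japInvSq hsa z := by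
    rw [← mul_apply_eq_comp, japPow_one_mul_self]
  rw [hJ] at h3 ⊢
  obtain rfl := h.mem_graph_snd_inj h1 h3 rfl
  rw [boundedTransform_comm] at h2
  exact h.mem_graph_snd_inj (boundedTransform_spec hsa _) h2 rfl

theorem japPow_half_half (hsa : IsSelfAdjoint h) (z : H) :
    japPow hsa (1 / 2) (japPow hsa (1 / 2) z) = japPow hsa 1 z := by
  rw [← mul_apply_eq_comp, ← japPow_add, add_halves]

theorem BoundedBelow.exists_nonneg (hsa : IsSelfAdjoint h) (hb : BoundedBelow h) :
    ∃ c : ℝ, 0 ≤ c ∧ ∀ x, 0 ≤ (inner ℂ x (boundedTransform hsa x + c • japPow hsa 1 x)).re := by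
  obtain ⟨c, hc⟩ := hb
  refine ⟨|c|, abs_nonneg c, fun x => ?_⟩
  -- At x = ⟨h⟩^(-1/2) z the form is that of h + |c| at ⟨h⟩⁻¹z, a vector of the domain of h; such x
  -- are dense.
  refine (japPow_denseRange hsa (1 / 2)).induction_on
    (p := fun x => 0 ≤ (inner ℂ x (boundedTransform hsa x + |c| • japPow hsa 1 x)).re) x
    (isClosed_le continuous_const (Complex.continuous_re.comp (by fun_prop))) fun z => ?_
  have h1 := boundedTransform_spec hsa z
  rw [LinearPMap.mem_graph_iff] at h1
  obtain ⟨u, hu, hu'⟩ := h1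
  have h2 := hc u
  rw [hu, hu'] at h2
  have e1 : inner ℂ (japPow hsa (1 / 2) z) (boundedTransform hsa (japPow hsa (1 / 2) z))
      = inner ℂ (japPow hsa 1 z) (boundedTransform hsa z) := by
    rw [boundedTransform_comm, ← japPow_symm, japPow_half_half]
  have e2 : inner ℂ (japPow hsa (1 / 2) z) (japPow hsa 1 (japPow hsa (1 / 2) z))
      = ((‖japPow hsa 1 z‖ ^ 2 : ℝ) : ℂ) := by
    rw [← japPow_half_half hsa (japPow hsa (1 / 2) z), ← japPow_symm, japPow_half_half,
      inner_self_eq_norm_sq_to_K]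
    push_cast
    rfl
  rw [inner_add_right, Complex.add_re, e1, inner_smul_right_eq_smul, e2, Complex.smul_re,
    Complex.ofReal_re, smul_eq_mul]
  nlinarith [neg_abs_le c, sq_nonneg ‖japPow hsa 1 z‖]

/-- Q is the square root of ⟨h⟩^(-1/2)(h + c)⟨h⟩^(-1/2), so ‖Q⟨h⟩^(1/2)u‖² is the form of h + c at
u. The lower bound says that for this c the form defines the norm of ⟨h⟩^(-1/2)H. -/
theorem BoundedBelow.exists_sqrt (hsa : IsSelfAdjoint h) (hb : BoundedBelow h) :
    ∃ c : ℝ, 0 ≤ c ∧ ∃ Q : H →L[ℂ] H,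
      (∀ x y, inner ℂ (Q x) (Q y) = inner ℂ x (boundedTransform hsa y + c • japPow hsa 1 y)) ∧
      ∃ δ > 0, ∀ x, δ * ‖x‖ ≤ ‖Q x‖ := by
  obtain ⟨b, hb0, hb⟩ := hb.exists_nonneg hsa
  set T := boundedTransform hsa with hT
  set J := japPow hsa 1 with hJ
  have hTs : ∀ x y, inner ℂ (T x) y = inner ℂ x (T y) := boundedTransform_symm hsa
  have hJs : ∀ x y, inner ℂ (J x) y = inner ℂ x (J y) := japPow_symm hsa 1
  have hbJ : ∀ x, 0 ≤ (inner ℂ (T x + b • J x) (J x)).re := fun x => by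
    have h1 := hb (japPow hsa (1 / 2) x)
    have e : inner ℂ (T x + b • J x) (J x) = inner ℂ (T (japPow hsa (1 / 2) x) +
        b • J (japPow hsa (1 / 2) x)) (japPow hsa (1 / 2) x) := by
      have hc : J (japPow hsa (1 / 2) x) = japPow hsa (1 / 2) (J x) := by
        rw [hJ, ← mul_apply_eq_comp, ← mul_apply_eq_comp, ← japPow_add, ← japPow_add, add_comm]
      rw [hc, hT, boundedTransform_comm, ← (japPow hsa (1 / 2)).map_smul_of_tower, ← map_add, japPow_symm,
        japPow_half_half]
    rwa [e, ← inner_conj_symm, Complex.conj_re]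
  -- In terms of T + bJ, the difference ‖Tx + cJx‖² − ‖x‖² is 2(b² + 1 + b)Re((T + bJ)x|Jx) + (b² +
  -- 1)b²‖Jx‖², and both terms are nonnegative.
  set c : ℝ := b + (b ^ 2 + 1) with hc
  have hexp : ∀ x, ‖x‖ ≤ ‖T x + c • J x‖ := fun x => by
    have h1 : ‖x‖ ^ 2 = ‖T x‖ ^ 2 + ‖J x‖ ^ 2 := by
      have : (inner ℂ (T x) (T x) : ℂ) = inner ℂ x x - inner ℂ (J x) (J x) := by
        rw [hTs, boundedTransform_boundedTransform, inner_sub_right, ← hJs]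
      simp only [inner_self_eq_norm_sq_to_K] at this
      have h2 : ‖T x‖ ^ 2 = ‖x‖ ^ 2 - ‖J x‖ ^ 2 := by exact_mod_cast this
      linarith
    have h2 : ‖T x‖ ^ 2 = ‖T x + b • J x‖ ^ 2 -
        2 * b * (inner ℂ (T x + b • J x) (J x)).re + b ^ 2 * ‖J x‖ ^ 2 := by
      have := norm_sub_sq (𝕜 := ℂ) (T x + b • J x) (b • J x)
      rw [add_sub_cancel_right, inner_smul_right_eq_smul, norm_smul, mul_pow, Real.norm_eq_abs,
        sq_abs, RCLike.re_to_complex, Complex.smul_re, smul_eq_mul] at this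
      linarith
    have h3 : ‖T x + c • J x‖ ^ 2 = ‖T x + b • J x‖ ^ 2 +
        2 * (b ^ 2 + 1) * (inner ℂ (T x + b • J x) (J x)).re + (b ^ 2 + 1) ^ 2 * ‖J x‖ ^ 2 := by
      have := norm_add_sq (𝕜 := ℂ) (T x + b • J x) ((b ^ 2 + 1) • J x)
      rw [add_assoc, ← add_smul, inner_smul_right_eq_smul, norm_smul, mul_pow, Real.norm_eq_abs,
        sq_abs, RCLike.re_to_complex, Complex.smul_re, smul_eq_mul] at this
      linarith
    refine le_of_sq_le_sq ?_ (norm_nonneg _)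
    rw [h3, h1, h2]
    have h4 := mul_nonneg (by positivity : 0 ≤ 2 * (b ^ 2 + 1) + 2 * b) (hbJ x)
    have h5 := mul_nonneg (by positivity : 0 ≤ (b ^ 2 + 1) * b ^ 2) (sq_nonneg ‖J x‖)
    nlinarith
  have hpos : ∀ x, 0 ≤ (inner ℂ x (T x + c • J x)).re := fun x => by
    have h1 := hb x
    have h2 : (inner ℂ x (J x)) = ((‖japPow hsa (1 / 2) x‖ ^ 2 : ℝ) : ℂ) := by
      rw [hJ, ← japPow_half_half, ← japPow_symm, inner_self_eq_norm_sq_to_K]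
      push_cast
      rfl
    rw [inner_add_right, inner_smul_right_eq_smul, h2, Complex.add_re, Complex.smul_re,
      Complex.ofReal_re, smul_eq_mul] at h1 ⊢
    nlinarith [mul_nonneg (by positivity : 0 ≤ b ^ 2 + 1) (sq_nonneg ‖japPow hsa (1 / 2) x‖)]
  set P : H →L[ℂ] H := T + c • J with hP
  have hP0 : 0 ≤ P := by
    rw [ContinuousLinearMap.nonneg_iff_isPositive, ContinuousLinearMap.isPositive_def']
    have hs : P.IsSymmetric := fun x y => by
      change inner ℂ (T x + c • J x) y = inner ℂ x (T y + c • J y)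
      rw [inner_add_left, inner_add_right, hTs, inner_smul_left_eq_smul, inner_smul_right_eq_smul,
        hJs]
    refine ⟨ContinuousLinearMap.isSelfAdjoint_iff_isSymmetric.mpr hs, fun x => ?_⟩
    rw [ContinuousLinearMap.reApplyInnerSelf_apply, RCLike.re_to_complex, ← inner_conj_symm,
      Complex.conj_re]
    exact hpos x
  have hQs : ∀ x y, inner ℂ (CFC.sqrt P x) y = inner ℂ x (CFC.sqrt P y) :=
    ((ContinuousLinearMap.nonneg_iff_isPositive _).mp (CFC.sqrt_nonneg P)).isSelfAdjoint.isSymmetric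
  have hQQ : ∀ y, CFC.sqrt P (CFC.sqrt P y) = T y + c • J y := fun y => by
    rw [← mul_apply_eq_comp, CFC.sqrt_mul_sqrt_self P hP0]
    rfl
  refine ⟨c, by positivity, CFC.sqrt P, fun x y => by rw [hQs, hQQ],
    1 / (‖CFC.sqrt P‖ + 1), by positivity, fun x => ?_⟩
  rw [one_div_mul_eq_div, div_le_iff₀ (by positivity)]
  have h1 := hexp x
  rw [← hQQ] at h1
  have h2 := (CFC.sqrt P).le_opNorm (CFC.sqrt P x)
  nlinarith [norm_nonneg (CFC.sqrt P x)]

variable (hsa : IsSelfAdjoint h)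

/-! ### Functionals on the Sobolev spaces -/

/-- The functional `v ↦ (⟨h⟩ˢ v | y)` on `⟨h⟩⁻ˢ H`. -/
def sobDual (s : ℝ≥0) : H →L[ℂ] AntiDual (Sob hsa s) :=
  adjointMap ((Sob.jap hsa s).toContinuousLinearEquiv : Sob hsa s →L[ℂ] H) ∘L riesz

theorem sobDual_apply (s : ℝ≥0) (y : H) (v : Sob hsa s) :
    sobDual hsa s y v = inner ℂ (Sob.jap hsa s v) y := rfl

theorem inner_incl (s : ℝ≥0) (v : Sob hsa s) (y : H) :
    inner ℂ (Sob.incl hsa s v) y = inner ℂ (Sob.jap hsa s v) (japPow hsa s y) :=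
  japPow_symm hsa s _ y

theorem sobDual_japPow (s : ℝ≥0) (y : H) : sobDual hsa s (japPow hsa s y) = Sob.toDual hsa s y := by
  ext v
  rw [sobDual_apply, Sob.toDual_apply, inner_incl]

theorem sobDual_surjective (s : ℝ≥0) : Function.Surjective (sobDual hsa s) := by
  intro f
  obtain ⟨y, hy⟩ := riesz_surjective (E := H)
    (adjointMap ((Sob.jap hsa s).symm.toContinuousLinearEquiv : H →L[ℂ] Sob hsa s) f)
  refine ⟨y, ?_⟩
  ext v
  change riesz y (Sob.jap hsa s v) = f v
  rw [hy, adjointMap_apply]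
  congr 1
  exact (Sob.jap hsa s).symm_apply_apply v

theorem norm_sobDual (s : ℝ≥0) (y : H) : ‖sobDual hsa s y‖ = ‖y‖ := by
  apply le_antisymm
  · refine ContinuousLinearMap.opNorm_le_bound _ (norm_nonneg y) fun v => ?_
    rw [sobDual_apply, mul_comm, Sob.norm_def]
    exact norm_inner_le_norm _ _
  · have h1 := (sobDual hsa s y).le_opNorm ((Sob.jap hsa s).symm y)
    rw [sobDual_apply, LinearIsometryEquiv.apply_symm_apply, LinearIsometryEquiv.norm_map,
      inner_self_eq_norm_sq_to_K, norm_pow, RCLike.norm_ofReal, abs_norm] at h1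
    rcases (norm_nonneg y).eq_or_lt with h0 | h0
    · rw [← h0]; positivity
    · nlinarith

theorem sobDual_injective (s : ℝ≥0) : Function.Injective (sobDual hsa s) :=
  (AddMonoidHomClass.isometry_of_norm _ (norm_sobDual hsa s)).injective

theorem toDual_denseRange (s : ℝ≥0) : DenseRange (Sob.toDual hsa s) := by
  have h1 : (Sob.toDual hsa s : H → AntiDual (Sob hsa s)) = sobDual hsa s ∘ japPow hsa s := by
    ext1 y
    exact (sobDual_japPow hsa s y).symm
  rw [h1]
  exact (sobDual_surjective hsa s).denseRange.comp (japPow_denseRange hsa s)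
    (sobDual hsa s).continuous

theorem adjointMap_inclLE_toDual {s t : ℝ≥0} (hst : s ≤ t) (y : H) :
    adjointMap (Sob.inclLE hsa hst) (Sob.toDual hsa s y) = Sob.toDual hsa t y := by
  ext v
  rw [adjointMap_apply, Sob.toDual_apply, Sob.toDual_apply, Sob.incl_inclLE]

/-! ### Embeddings -/

/-- The embedding of the energy space into its adjoint space. -/
def energyToDual : EnergySpace hsa →L[ℂ] EnergySpaceDual hsa :=
  (Sob.incl hsa (1 / 2)).prodMap (Sob.toDual hsa (1 / 2))

theorem energyToDual_apply (x : EnergySpace hsa) :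
    energyToDual hsa x = (Sob.incl hsa (1 / 2) x.1, Sob.toDual hsa (1 / 2) x.2) := rfl

theorem chargeToDual_energyToCharge {θ : ℝ≥0} (hθ : θ ≤ 1 / 2) (x : EnergySpace hsa) :
    chargeToDual hsa hθ (energyToCharge hsa hθ x) = energyToDual hsa x :=
  Prod.ext (Sob.incl_inclLE hsa hθ x.1) (adjointMap_inclLE_toDual hsa hθ x.2)

theorem energyToCharge_denseRange {θ : ℝ≥0} (hθ : θ ≤ 1 / 2) :
    DenseRange (energyToCharge hsa hθ) :=
  (Sob.inclLE_denseRange hsa hθ).prodMap (toDual_denseRange hsa θ)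

theorem energyToDual_denseRange : DenseRange (energyToDual hsa) :=
  (Sob.incl_denseRange hsa _).prodMap (toDual_denseRange hsa _)

theorem chargeToDual_denseRange {θ : ℝ≥0} (hθ : θ ≤ 1 / 2) : DenseRange (chargeToDual hsa hθ) := by
  refine (energyToDual_denseRange hsa).mono ?_
  rintro _ ⟨x, rfl⟩
  exact ⟨_, chargeToDual_energyToCharge hsa hθ x⟩

/-! ### The resolvent of the Klein-Gordon operator -/

variable {hsa} {k : Sob hsa (1 / 2) →L[ℂ] H}

theorem SymmetricOnSob.im_inner_eq_zero (hk : SymmetricOnSob hsa k) (u : Sob hsa (1 / 2)) :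
    (inner ℂ (Sob.incl hsa (1 / 2) u) (k u)).im = 0 := by
  refine Complex.conj_eq_iff_im.mp ?_
  rw [inner_conj_symm]
  exact hk u u

theorem hZero_apply (u v : Sob hsa (1 / 2)) :
    hZero hsa k u v = inner ℂ (Sob.jap hsa (1 / 2) v) (boundedTransform hsa (Sob.jap hsa (1 / 2) u))
      + inner ℂ (k v) (k u) := rfl

theorem kExt_apply (y : H) (v : Sob hsa (1 / 2)) : kExt hsa k y v = inner ℂ (k v) y := rfl

/-- The operator `l - i K` from the energy space to its adjoint space. -/
def kgShift (k : Sob hsa (1 / 2) →L[ℂ] H) (l : ℝ) : EnergySpace hsa →L[ℂ] EnergySpaceDual hsa :=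
  (l : ℂ) • energyToDual hsa - Complex.I • kgOperator hsa k

theorem kgShift_apply (l : ℝ) (x : EnergySpace hsa) : kgShift k l x =
    (l : ℂ) • energyToDual hsa x - Complex.I • kgOperator hsa k x := rfl

/-- The operator `⟨h⟩^(-1/2) (h - 2 i l k + l²) ⟨h⟩^(-1/2)` on `H`. -/
def kgPencil (k : Sob hsa (1 / 2) →L[ℂ] H) (l : ℝ) : H →L[ℂ] H :=
  boundedTransform hsa + ((l : ℂ) ^ 2) • japPow hsa 1 - (2 * Complex.I * l) •
    (japPow hsa (1 / 2) ∘L k ∘L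
      ((Sob.jap hsa (1 / 2)).symm.toContinuousLinearEquiv : H →L[ℂ] Sob hsa (1 / 2)))

theorem inner_kgPencil (l : ℝ) (u v : Sob hsa (1 / 2)) :
    inner ℂ (Sob.jap hsa (1 / 2) v) (kgPencil k l (Sob.jap hsa (1 / 2) u)) =
      inner ℂ (Sob.jap hsa (1 / 2) v) (boundedTransform hsa (Sob.jap hsa (1 / 2) u)) +
      (l : ℂ) ^ 2 * inner ℂ (Sob.incl hsa (1 / 2) v) (Sob.incl hsa (1 / 2) u) -
      2 * Complex.I * l * inner ℂ (Sob.incl hsa (1 / 2) v) (k u) := by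
  have e : kgPencil k l (Sob.jap hsa (1 / 2) u) = boundedTransform hsa (Sob.jap hsa (1 / 2) u) +
      ((l : ℂ) ^ 2) • japPow hsa 1 (Sob.jap hsa (1 / 2) u) - (2 * Complex.I * l) •
      japPow hsa (1 / 2) (k ((Sob.jap hsa (1 / 2)).symm (Sob.jap hsa (1 / 2) u))) := rfl
  rw [e, LinearIsometryEquiv.symm_apply_apply, inner_sub_right, inner_add_right, inner_smul_right,
    inner_smul_right, ← japPow_half_half, ← inner_incl, ← inner_incl]
  rfl

/-- Lax–Milgram: for real l the k-term is purely imaginary on the diagonal, and the rest dominates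
‖Qx‖² because c ≤ l². -/
theorem kgPencil_isUnit (hk : SymmetricOnSob hsa k) {c δ l : ℝ} {Q : H →L[ℂ] H} (hδ : 0 < δ)
    (hQ : ∀ x y, inner ℂ (Q x) (Q y) = inner ℂ x (boundedTransform hsa y + c • japPow hsa 1 y))
    (hQδ : ∀ x, δ * ‖x‖ ≤ ‖Q x‖) (hl : c ≤ l ^ 2) : IsUnit (kgPencil k l) := by
  refine ContinuousLinearMap.isUnit_of_forall_le_norm_inner_map (𝕜 := ℂ) _
    (c := ⟨δ ^ 2, sq_nonneg δ⟩) (by positivity : (0 : ℝ) < δ ^ 2) fun x => ?_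
  obtain ⟨u, rfl⟩ := (Sob.jap hsa (1 / 2)).surjective x
  set x := Sob.jap hsa (1 / 2) u
  rw [norm_inner_symm]
  refine le_trans ?_ (Complex.re_le_norm _)
  rw [inner_kgPencil]
  have h1 := congrArg Complex.re (hQ x x)
  have h2 : inner ℂ x (japPow hsa 1 x) = inner ℂ (Sob.incl hsa (1 / 2) u) (Sob.incl hsa (1 / 2) u) := by
    rw [inner_incl, ← japPow_half_half]; rfl
  have h3 := hQδ x
  rw [inner_add_right, inner_smul_right_eq_smul, h2] at h1
  have h4 := hk.im_inner_eq_zero u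
  simp only [inner_self_eq_norm_sq_to_K, Complex.add_re, Complex.smul_re, smul_eq_mul] at h1 ⊢
  have h5 : ((2 : ℂ) * Complex.I * l * inner ℂ (Sob.incl hsa (1 / 2) u) (k u)).re = 0 := by
    simp [Complex.mul_re, Complex.mul_im, h4]
  have h6 : ((l : ℂ) ^ 2 * (((‖Sob.incl hsa (1 / 2) u‖ : ℝ) : ℂ)) ^ 2).re
      = l ^ 2 * ‖Sob.incl hsa (1 / 2) u‖ ^ 2 := by norm_cast
  have h7 : ((((‖Sob.incl hsa (1 / 2) u‖ : ℝ) : ℂ)) ^ 2).re = ‖Sob.incl hsa (1 / 2) u‖ ^ 2 := by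
    norm_cast
  have h8 : ((((‖Q x‖ : ℝ) : ℂ)) ^ 2).re = ‖Q x‖ ^ 2 := by norm_cast
  simp only [Complex.coe_algebraMap] at h1 ⊢
  rw [h7, h8] at h1
  rw [Complex.sub_re, Complex.add_re, h5, h6]
  change ‖x‖ ^ 2 * δ ^ 2 ≤ _
  have h9 : (δ * ‖x‖) ^ 2 ≤ ‖Q x‖ ^ 2 := by gcongr
  nlinarith [mul_le_mul_of_nonneg_right hl (sq_nonneg ‖Sob.incl hsa (1 / 2) u‖)]

/-- Schur complement. The first row determines u₁; inserting it in the second row and multiplying by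
i cancels k²u₀ and leaves the pencil. -/
theorem kgShift_eq_iff (hk : SymmetricOnSob hsa k) (l : ℝ) (u : EnergySpace hsa)
    (w : EnergySpaceDual hsa) :
    kgShift k l u = w ↔
      u.2 = Complex.I • w.1 - (Complex.I * l) • Sob.incl hsa (1 / 2) u.1 - k u.1 ∧
      sobDual hsa (1 / 2) (kgPencil k l (Sob.jap hsa (1 / 2) u.1)) =
        Complex.I • w.2 + (l : ℂ) • Sob.toDual hsa (1 / 2) w.1 - Complex.I • kExt hsa k w.1 := by
  obtain ⟨u0, u1⟩ := u
  obtain ⟨f, g⟩ := w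
  have hI := Complex.I_mul_I
  have e1 : (kgShift k l (u0, u1)).1 =
      (l : ℂ) • Sob.incl hsa (1 / 2) u0 - Complex.I • (k u0 + u1) := rfl
  have e2 : ∀ v, (kgShift k l (u0, u1)).2 v = l * inner ℂ (Sob.incl hsa (1 / 2) v) u1 -
      Complex.I * (inner ℂ (Sob.jap hsa (1 / 2) v)
        (boundedTransform hsa (Sob.jap hsa (1 / 2) u0)) + inner ℂ (k v) (k u0)
          + inner ℂ (k v) u1) := fun v => rfl
  have key1 : (l : ℂ) • Sob.incl hsa (1 / 2) u0 - Complex.I • (k u0 + u1) = f ↔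
      u1 = Complex.I • f - (Complex.I * l) • Sob.incl hsa (1 / 2) u0 - k u0 := by
    constructor
    · rintro rfl
      rw [smul_sub, smul_smul, smul_smul, hI, neg_one_smul]
      abel
    · rintro rfl
      rw [add_sub_cancel, smul_sub, smul_smul, smul_smul, ← mul_assoc, hI, neg_one_mul, neg_one_smul,
        neg_smul]
      abel
  rw [Prod.ext_iff, e1, key1]
  refine and_congr_right fun hu1 => ?_
  dsimp only at hu1 ⊢
  have key2 : ∀ v, Complex.I * (kgShift k l (u0, u1)).2 v =
      sobDual hsa (1 / 2) (kgPencil k l (Sob.jap hsa (1 / 2) u0)) v -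
        (l * inner ℂ (Sob.incl hsa (1 / 2) v) f - Complex.I * inner ℂ (k v) f) := fun v => by
    rw [e2, sobDual_apply, inner_kgPencil, hu1]
    simp only [inner_sub_right, inner_smul_right, hk v u0]
    linear_combination (-inner ℂ (Sob.jap hsa (1 / 2) v)
        (boundedTransform hsa (Sob.jap hsa (1 / 2) u0)) - inner ℂ (k v) f * Complex.I
          + l * inner ℂ (Sob.incl hsa (1 / 2) v) f
          + l * Complex.I * inner ℂ (Sob.incl hsa (1 / 2) v) (k u0)
          - l ^ 2 * inner ℂ (Sob.incl hsa (1 / 2) v) (Sob.incl hsa (1 / 2) u0)) * hI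
  constructor
  · intro hg
    ext v
    have h1 := key2 v
    rw [hg] at h1
    change _ = Complex.I * g v + l * inner ℂ (Sob.incl hsa (1 / 2) v) f -
      Complex.I * inner ℂ (k v) f
    linear_combination -h1
  · intro hg
    ext v
    have h1 := key2 v
    rw [hg] at h1
    change _ = Complex.I * g v + l * inner ℂ (Sob.incl hsa (1 / 2) v) f -
      Complex.I * inner ℂ (k v) f - _ at h1
    apply mul_left_cancel₀ Complex.I_ne_zero
    linear_combination h1

theorem exists_kgShift_inverse (hk : SymmetricOnSob hsa k) {l : ℝ} (hl : IsUnit (kgPencil k l)) :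
    ∃ S : EnergySpaceDual hsa →L[ℂ] EnergySpace hsa,
      (∀ w, kgShift k l (S w) = w) ∧ ∀ x, S (kgShift k l x) = x := by
  have hbij := (ContinuousLinearMap.isUnit_iff_bijective).mp hl
  have hker : (kgShift k l).ker = ⊥ := by
    rw [LinearMap.ker_eq_bot]
    intro u u' hu
    obtain ⟨h1, h2⟩ := (kgShift_eq_iff hk l u _).mp hu
    obtain ⟨h1', h2'⟩ := (kgShift_eq_iff hk l u' _).mp rfl
    have h3 := (Sob.jap hsa (1 / 2)).injective
      (hbij.1 (sobDual_injective hsa (1 / 2) (h2.trans h2'.symm)))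
    refine Prod.ext h3 ?_
    rw [h1, h1', h3]
    rfl
  have hrange : (kgShift k l).range = ⊤ := by
    rw [LinearMap.range_eq_top]
    intro w
    obtain ⟨y, hy⟩ := sobDual_surjective hsa (1 / 2)
      (Complex.I • w.2 + (l : ℂ) • Sob.toDual hsa (1 / 2) w.1 - Complex.I • kExt hsa k w.1)
    obtain ⟨x, rfl⟩ := hbij.2 y
    obtain ⟨u0, rfl⟩ := (Sob.jap hsa (1 / 2)).surjective x
    exact ⟨(u0, Complex.I • w.1 - (Complex.I * l) • Sob.incl hsa (1 / 2) u0 - k u0),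
      (kgShift_eq_iff hk l _ w).mpr ⟨rfl, hy⟩⟩
  let e := ContinuousLinearEquiv.ofBijective (kgShift k l) hker hrange
  exact ⟨e.symm, fun w => e.apply_symm_apply w, fun x => e.symm_apply_apply x⟩

/-! ### The energy -/

/-- `u ↦ (k u₀ + u₁, Q ⟨h⟩^(1/2) u₀)`; the energy of `u` is the square of the norm of this vector. -/
def energyMap (k : Sob hsa (1 / 2) →L[ℂ] H) (Q : H →L[ℂ] H) :
    EnergySpace hsa →L[ℂ] WithLp 2 (H × H) :=
  ((WithLp.prodContinuousLinearEquiv 2 ℂ H H).symm : (H × H) →L[ℂ] WithLp 2 (H × H)) ∘L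
    ((k.coprod (ContinuousLinearMap.id ℂ H)).prod
      (Q ∘L ((Sob.jap hsa (1 / 2)).toContinuousLinearEquiv : Sob hsa (1 / 2) →L[ℂ] H) ∘L
        ContinuousLinearMap.fst ℂ _ _))

theorem energyMap_apply (Q : H →L[ℂ] H) (x : EnergySpace hsa) :
    energyMap k Q x = WithLp.toLp 2 (k x.1 + x.2, Q (Sob.jap hsa (1 / 2) x.1)) := rfl

theorem exists_norm_le_energyMap (k : Sob hsa (1 / 2) →L[ℂ] H) {Q : H →L[ℂ] H} {δ : ℝ}
    (hδ : 0 < δ) (hQδ : ∀ x, δ * ‖x‖ ≤ ‖Q x‖) :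
    ∃ C : ℝ, 0 ≤ C ∧ ∀ x, ‖x‖ ≤ C * ‖energyMap k Q x‖ := by
  refine ⟨1 / δ + (1 + ‖k‖ * (1 / δ)), by positivity, fun x => ?_⟩
  have h1 : ‖k x.1 + x.2‖ ≤ ‖energyMap k Q x‖ := WithLp.norm_fst_le (p := 2) _ (energyMap k Q x)
  have h2 : ‖Q (Sob.jap hsa (1 / 2) x.1)‖ ≤ ‖energyMap k Q x‖ :=
    WithLp.norm_snd_le (p := 2) _ (energyMap k Q x)
  have h3 : ‖x.1‖ ≤ 1 / δ * ‖energyMap k Q x‖ := by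
    rw [one_div_mul_eq_div, le_div_iff₀ hδ, mul_comm, Sob.norm_def]
    exact (hQδ _).trans h2
  have h4 : ‖x.2‖ ≤ (1 + ‖k‖ * (1 / δ)) * ‖energyMap k Q x‖ := by
    have e : x.2 = k x.1 + x.2 - k x.1 := by abel
    rw [e]
    refine (norm_sub_le _ _).trans ?_
    have := (k.le_opNorm x.1).trans (mul_le_mul_of_nonneg_left h3 (norm_nonneg k))
    linarith
  have h5 : 0 ≤ 1 / δ * ‖energyMap k Q x‖ := by positivity
  have h6 : 0 ≤ (1 + ‖k‖ * (1 / δ)) * ‖energyMap k Q x‖ := by positivity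
  rw [Prod.norm_def, max_le_iff, add_mul]
  constructor <;> linarith

theorem kgOperator_eq_energyToDual {x y : EnergySpace hsa}
    (hxy : kgOperator hsa k x = energyToDual hsa y) :
    k x.1 + x.2 = Sob.incl hsa (1 / 2) y.1 ∧
    ∀ v, inner ℂ (Sob.jap hsa (1 / 2) v) (boundedTransform hsa (Sob.jap hsa (1 / 2) x.1))
      + inner ℂ (k v) (k x.1 + x.2) = inner ℂ (Sob.incl hsa (1 / 2) v) y.2 := by
  rw [kgOperator_apply, energyToDual_apply, Prod.ext_iff] at hxy
  refine ⟨hxy.1, fun v => ?_⟩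
  have := congrArg (fun f : AntiDual (Sob hsa (1 / 2)) => f v) hxy.2
  simp only [add_apply, hZero_apply, kExt_apply, Sob.toDual_apply] at this
  rw [← this, inner_add_right]
  ring

/-- With y = Kx, all terms of (Ψx|Ψy) are real or add up to real numbers, except c(x₀|y₀). The error
is quadratic in ‖Ψx‖ since y₀ = kx₀ + x₁ is itself a component of Ψx. -/
theorem abs_im_inner_energyMap_le (hk : SymmetricOnSob hsa k) {c δ : ℝ} {Q : H →L[ℂ] H}
    (hc : 0 ≤ c) (hδ : 0 < δ)
    (hQ : ∀ x y, inner ℂ (Q x) (Q y) = inner ℂ x (boundedTransform hsa y + c • japPow hsa 1 y))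
    (hQδ : ∀ x, δ * ‖x‖ ≤ ‖Q x‖) {x y : EnergySpace hsa}
    (hxy : kgOperator hsa k x = energyToDual hsa y) :
    |(inner ℂ (energyMap k Q x) (energyMap k Q y)).im| ≤
      c * (‖japPow hsa (1 / 2)‖ / δ) * ‖energyMap k Q x‖ ^ 2 := by
  obtain ⟨h1, h2⟩ := kgOperator_eq_energyToDual hxy
  have h3 : inner ℂ (energyMap k Q x) (energyMap k Q y) =
      inner ℂ (Sob.incl hsa (1 / 2) y.1) (k y.1) +
      (inner ℂ (Sob.jap hsa (1 / 2) y.1) (boundedTransform hsa (Sob.jap hsa (1 / 2) x.1)) +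
        inner ℂ (Sob.jap hsa (1 / 2) x.1) (boundedTransform hsa (Sob.jap hsa (1 / 2) y.1))) +
      inner ℂ (Sob.incl hsa (1 / 2) y.1) (k y.1) +
      c • inner ℂ (Sob.incl hsa (1 / 2) x.1) (Sob.incl hsa (1 / 2) y.1) := by
    have e : inner ℂ (Sob.jap hsa (1 / 2) x.1) (japPow hsa 1 (Sob.jap hsa (1 / 2) y.1)) =
        inner ℂ (Sob.incl hsa (1 / 2) x.1) (Sob.incl hsa (1 / 2) y.1) := by
      rw [inner_incl, ← japPow_half_half]; rfl
    rw [energyMap_apply, energyMap_apply, WithLp.prod_inner_apply]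
    dsimp only
    rw [hQ, h1, inner_add_right, ← h2, h1, inner_add_right, inner_smul_right_eq_smul, e, hk y.1 y.1]
    ring
  have h4 : (inner ℂ (Sob.jap hsa (1 / 2) y.1) (boundedTransform hsa (Sob.jap hsa (1 / 2) x.1)) +
        inner ℂ (Sob.jap hsa (1 / 2) x.1)
          (boundedTransform hsa (Sob.jap hsa (1 / 2) y.1))).im = 0 := by
    rw [← boundedTransform_symm, ← inner_conj_symm, Complex.add_im, Complex.conj_im]
    ring
  have h5 : ‖Sob.incl hsa (1 / 2) x.1‖ ≤ ‖japPow hsa (1 / 2)‖ / δ * ‖energyMap k Q x‖ := by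
    have a1 := (japPow hsa (1 / 2)).le_opNorm (Sob.jap hsa (1 / 2) x.1)
    have a2 := (hQδ (Sob.jap hsa (1 / 2) x.1)).trans
      (WithLp.norm_snd_le (p := 2) _ (energyMap k Q x))
    rw [div_mul_eq_mul_div, mul_div_assoc]
    refine a1.trans (mul_le_mul_of_nonneg_left ?_ (norm_nonneg _))
    rw [le_div_iff₀ hδ, mul_comm]
    exact a2
  have h6 : ‖Sob.incl hsa (1 / 2) y.1‖ ≤ ‖energyMap k Q x‖ := by
    rw [← h1]
    exact WithLp.norm_fst_le (p := 2) _ (energyMap k Q x)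
  rw [h3, Complex.add_im, Complex.add_im, Complex.add_im, h4, hk.im_inner_eq_zero, Complex.smul_im,
    smul_eq_mul]
  simp only [add_zero, zero_add]
  rw [abs_mul, abs_of_nonneg hc, mul_assoc]
  refine mul_le_mul_of_nonneg_left ?_ hc
  calc _ ≤ ‖Sob.incl hsa (1 / 2) x.1‖ * ‖Sob.incl hsa (1 / 2) y.1‖ :=
        (Complex.abs_im_le_norm _).trans (norm_inner_le_norm _ _)
    _ ≤ ‖japPow hsa (1 / 2)‖ / δ * ‖energyMap k Q x‖ * ‖energyMap k Q x‖ := by gcongr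
    _ = _ := by ring

theorem eq_I_smul_sub_I_smul_sub {Y : Type*} [AddCommGroup Y] [Module ℂ Y] (a b : Y) :
    b = Complex.I • (a - Complex.I • b - a) := by
  rw [sub_sub_cancel_left, smul_neg, smul_smul, Complex.I_mul_I, neg_smul, one_smul, neg_neg]

theorem kgOperator_of_kgShift_eq {l : ℝ} {x : EnergySpace hsa} {w : EnergySpaceDual hsa}
    (hx : kgShift k l x = w) :
    kgOperator hsa k x = Complex.I • (w - (l : ℂ) • energyToDual hsa x) := by
  rw [← hx]
  exact eq_I_smul_sub_I_smul_sub ((l : ℂ) • energyToDual hsa x) (kgOperator hsa k x)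

/-- From Kx = i(y − lx) one gets Im(Ψx|ΨKx) = Re(Ψx|Ψy) − l‖Ψx‖²; the almost-symmetry of K bounds
the left side. No constant appears in front of ‖Ψy‖, so the inequality can be iterated. -/
theorem norm_energyMap_le (hk : SymmetricOnSob hsa k) {c δ : ℝ} {Q : H →L[ℂ] H}
    (hc : 0 ≤ c) (hδ : 0 < δ)
    (hQ : ∀ x y, inner ℂ (Q x) (Q y) = inner ℂ x (boundedTransform hsa y + c • japPow hsa 1 y))
    (hQδ : ∀ x, δ * ‖x‖ ≤ ‖Q x‖) {l : ℝ} {x y : EnergySpace hsa}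
    (hxy : kgShift k l x = energyToDual hsa y) :
    (|l| - c * (‖japPow hsa (1 / 2)‖ / δ)) * ‖energyMap k Q x‖ ≤ ‖energyMap k Q y‖ := by
  have h1 : kgOperator hsa k x = energyToDual hsa (Complex.I • (y - (l : ℂ) • x)) := by
    rw [kgOperator_of_kgShift_eq hxy, map_smul, map_sub, map_smul]
  have h2 := abs_im_inner_energyMap_le hk hc hδ hQ hQδ h1
  set Ψ := energyMap k Q
  rw [map_smul, map_sub, map_smul, inner_smul_right, inner_sub_right, inner_smul_right,
    inner_self_eq_norm_sq_to_K, Complex.I_mul_im, Complex.sub_re] at h2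
  have h3 : ((l : ℂ) * ((algebraMap ℝ ℂ) ‖Ψ x‖) ^ 2).re = l * ‖Ψ x‖ ^ 2 := by
    rw [Complex.coe_algebraMap]
    norm_cast
  have h4 := (Complex.abs_re_le_norm _).trans (norm_inner_le_norm (𝕜 := ℂ) (Ψ x) (Ψ y))
  change |_ - ((l : ℂ) * ((algebraMap ℝ ℂ) ‖Ψ x‖) ^ 2).re| ≤ _ at h2
  rw [h3] at h2
  have h5 : |l| * ‖Ψ x‖ ^ 2 ≤ ‖Ψ x‖ * ‖Ψ y‖ +
      c * (‖japPow hsa (1 / 2)‖ / δ) * ‖Ψ x‖ ^ 2 := by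
    have := abs_sub_abs_le_abs_sub (l * ‖Ψ x‖ ^ 2) (inner ℂ (Ψ x) (Ψ y)).re
    rw [abs_sub_comm, abs_mul, abs_of_nonneg (sq_nonneg ‖Ψ x‖)] at this
    linarith
  rcases (norm_nonneg (Ψ x)).eq_or_lt with h0 | h0
  · rw [← h0, mul_zero]
    exact norm_nonneg _
  · nlinarith

/-! ### The charge form -/

/-- The charge form `(u₀ | v₁) + (u₁ | v₀)`. -/
def chargeForm (u v : EnergySpace hsa) : ℂ :=
  inner ℂ (Sob.incl hsa (1 / 2) u.1) v.2 + inner ℂ u.2 (Sob.incl hsa (1 / 2) v.1)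

/-- Both sides equal the sesquilinear form (x₀|hy₀) + (kx₀ + x₁|ky₀ + y₁), by the symmetry of h. -/
theorem chargeForm_kgOperator {x x' y y' : EnergySpace hsa}
    (hx : kgOperator hsa k x = energyToDual hsa x') (hy : kgOperator hsa k y = energyToDual hsa y') :
    chargeForm x' y = chargeForm x y' := by
  obtain ⟨h1, h2⟩ := kgOperator_eq_energyToDual hx
  obtain ⟨h3, h4⟩ := kgOperator_eq_energyToDual hy
  rw [chargeForm, chargeForm, ← h1, ← h3, ← h4, ← inner_conj_symm x'.2, ← h2, map_add,
    inner_conj_symm, inner_conj_symm, boundedTransform_symm]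
  simp only [inner_add_left, inner_add_right]
  ring

theorem chargeForm_sub_left (u u' v : EnergySpace hsa) :
    chargeForm (u - u') v = chargeForm u v - chargeForm u' v := by
  simp only [chargeForm, Prod.fst_sub, Prod.snd_sub, map_sub, inner_sub_left]
  ring

theorem chargeForm_sub_right (u v v' : EnergySpace hsa) :
    chargeForm u (v - v') = chargeForm u v - chargeForm u v' := by
  simp only [chargeForm, Prod.fst_sub, Prod.snd_sub, map_sub, inner_sub_right]
  ring

theorem chargeForm_smul_left (a : ℂ) (u v : EnergySpace hsa) :
    chargeForm (a • u) v = (starRingEnd ℂ) a * chargeForm u v := by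
  simp only [chargeForm, Prod.smul_fst, Prod.smul_snd, map_smul, inner_smul_left]
  ring

theorem chargeForm_smul_right (a : ℂ) (u v : EnergySpace hsa) :
    chargeForm u (a • v) = a * chargeForm u v := by
  simp only [chargeForm, Prod.smul_fst, Prod.smul_snd, map_smul, inner_smul_right]
  ring

/-- For the charge form the adjoint of l − iK is l + iK = −((−l) − iK), so the resolvent at l has
adjoint minus the resolvent at −l. -/
theorem chargeForm_kgShift {l : ℝ} {a b x y : EnergySpace hsa}
    (ha : kgShift k l a = energyToDual hsa x) (hb : kgShift k (-l) b = energyToDual hsa y) :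
    chargeForm a y = - chargeForm x b := by
  have h1 : kgOperator hsa k a = energyToDual hsa (Complex.I • (x - (l : ℂ) • a)) := by
    rw [kgOperator_of_kgShift_eq ha, map_smul, map_sub, map_smul]
  have h2 : kgOperator hsa k b = energyToDual hsa (Complex.I • (y - ((-l : ℝ) : ℂ) • b)) := by
    rw [kgOperator_of_kgShift_eq hb, map_smul, map_sub, map_smul]
  have h3 := chargeForm_kgOperator h1 h2
  rw [chargeForm_smul_left, chargeForm_sub_left, chargeForm_smul_left, chargeForm_smul_right,
    chargeForm_sub_right, chargeForm_smul_right, Complex.conj_I, Complex.conj_ofReal,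
    Complex.ofReal_neg] at h3
  linear_combination Complex.I * h3 + (chargeForm x b + chargeForm a y) * Complex.I_mul_I

/-- The involution `(u₀, u₁) ↦ (⟨h⟩^(-1/2) u₁, ⟨h⟩^(1/2) u₀)`. -/
def chargeSwap (hsa : IsSelfAdjoint h) : EnergySpace hsa →L[ℂ] EnergySpace hsa :=
  (((Sob.jap hsa (1 / 2)).symm.toContinuousLinearEquiv : H →L[ℂ] Sob hsa (1 / 2)) ∘L
    ContinuousLinearMap.snd ℂ _ _).prod
  (((Sob.jap hsa (1 / 2)).toContinuousLinearEquiv : Sob hsa (1 / 2) →L[ℂ] H) ∘L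
    ContinuousLinearMap.fst ℂ _ _)

theorem chargeSwap_apply (x : EnergySpace hsa) :
    chargeSwap hsa x = ((Sob.jap hsa (1 / 2)).symm x.2, Sob.jap hsa (1 / 2) x.1) := rfl

theorem chargeSwap_chargeSwap (x : EnergySpace hsa) : chargeSwap hsa (chargeSwap hsa x) = x := by
  simp [chargeSwap_apply]

theorem norm_chargeSwap_le : ‖chargeSwap hsa‖ ≤ 1 := by
  refine ContinuousLinearMap.opNorm_le_bound _ zero_le_one fun x => ?_
  rw [chargeSwap_apply, one_mul, Prod.norm_def, Prod.norm_def, LinearIsometryEquiv.norm_map,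
    LinearIsometryEquiv.norm_map, max_comm]

/-- The embedding of the energy space into the charge space of order `1/4`, the latter identified
with `H ⊕ H`. -/
def energyToCharge' (hsa : IsSelfAdjoint h) : EnergySpace hsa →L[ℂ] WithLp 2 (H × H) :=
  ((WithLp.prodContinuousLinearEquiv 2 ℂ H H).symm : (H × H) →L[ℂ] WithLp 2 (H × H)) ∘L
    ((japPow hsa (1 / 4) ∘L
      ((Sob.jap hsa (1 / 2)).toContinuousLinearEquiv : Sob hsa (1 / 2) →L[ℂ] H)).prodMap
        (japPow hsa (1 / 4)))

theorem energyToCharge'_apply (x : EnergySpace hsa) : energyToCharge' hsa x =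
    WithLp.toLp 2 (japPow hsa (1 / 4) (Sob.jap hsa (1 / 2) x.1), japPow hsa (1 / 4) x.2) := rfl

theorem half_sub_quarter : (1 / 2 - 1 / 4 : ℝ≥0) = 1 / 4 := by
  rw [tsub_eq_iff_eq_add_of_le quarter_le_half, ← add_div]
  norm_num

theorem quarter_add_quarter : (1 / 4 + 1 / 4 : ℝ≥0) = 1 / 2 := by
  rw [← add_div]
  norm_num

/-- This is where the order 1/4 enters: moving both quarter powers to one side produces exactly the
powers ±1/2 in the swap, which preserve the energy space. -/
theorem inner_energyToCharge' (x y : EnergySpace hsa) :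
    inner ℂ (energyToCharge' hsa x) (energyToCharge' hsa y) = chargeForm x (chargeSwap hsa y) := by
  have hJ : ∀ z, japPow hsa (1 / 4) (japPow hsa (1 / 4) z) = japPow hsa (1 / 2) z := fun z => by
    rw [← mul_apply_eq_comp, ← japPow_add, quarter_add_quarter]
  rw [energyToCharge'_apply, energyToCharge'_apply, WithLp.prod_inner_apply, chargeForm,
    chargeSwap_apply]
  dsimp only
  rw [japPow_symm, japPow_symm, hJ, hJ, inner_incl, Sob.incl_jap_symm]

theorem norm_energyToCharge (x : EnergySpace hsa) :
    ‖energyToCharge hsa quarter_le_half x‖ =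
      max ‖(energyToCharge' hsa x).fst‖ ‖(energyToCharge' hsa x).snd‖ := by
  have h1 : (energyToCharge hsa quarter_le_half x).1 =
      (Sob.jap hsa (1 / 4)).symm (japPow hsa (1 / 2 - 1 / 4) (Sob.jap hsa (1 / 2) x.1)) := rfl
  have h2 : (energyToCharge hsa quarter_le_half x).2 = Sob.toDual hsa (1 / 4) x.2 := rfl
  rw [Prod.norm_def, h1, h2, LinearIsometryEquiv.norm_map, ← sobDual_japPow, norm_sobDual,
    half_sub_quarter]
  rfl

theorem norm_energyToCharge_le (x : EnergySpace hsa) :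
    ‖energyToCharge hsa quarter_le_half x‖ ≤ ‖energyToCharge' hsa x‖ := by
  rw [norm_energyToCharge]
  exact max_le (WithLp.norm_fst_le (p := 2) _ _) (WithLp.norm_snd_le (p := 2) _ _)

theorem norm_energyToCharge'_le (x : EnergySpace hsa) :
    ‖energyToCharge' hsa x‖ ≤ 2 * ‖energyToCharge hsa quarter_le_half x‖ := by
  rw [norm_energyToCharge]
  refine le_of_sq_le_sq ?_ (by positivity)
  rw [WithLp.prod_norm_sq_eq_of_L2, mul_pow]
  have h1 := pow_le_pow_left₀ (norm_nonneg _)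
    (le_max_left ‖(energyToCharge' hsa x).fst‖ ‖(energyToCharge' hsa x).snd‖) 2
  have h2 := pow_le_pow_left₀ (norm_nonneg _)
    (le_max_right ‖(energyToCharge' hsa x).fst‖ ‖(energyToCharge' hsa x).snd‖) 2
  nlinarith

/-! ### Resolvent estimates -/

section general

variable {Y Z : Type*} [NormedAddCommGroup Y] [NormedSpace ℂ Y] [NormedAddCommGroup Z]
  [NormedSpace ℂ Z]

theorem norm_mul_mul_le_of_norm_le_one {j : Y →L[ℂ] Y} (hj : ‖j‖ ≤ 1) (A : Y →L[ℂ] Y) :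
    ‖j * A * j‖ ≤ ‖A‖ :=
  calc ‖j * A * j‖ ≤ ‖j‖ * ‖A‖ * ‖j‖ :=
        (norm_mul_le _ _).trans (mul_le_mul_of_nonneg_right (norm_mul_le _ _) (norm_nonneg _))
    _ ≤ 1 * ‖A‖ * 1 := by gcongr
    _ = ‖A‖ := by ring

theorem neg_I_smul_I_smul (y : Y) : -(Complex.I • Complex.I • y) = y := by
  rw [smul_smul, Complex.I_mul_I, neg_one_smul, neg_neg]

theorem I_smul_sub_eq_neg (l : ℝ) (a w : Y) :
    Complex.I • (w - (l : ℂ) • a) = -(Complex.I • (l • a - w)) := by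
  rw [← smul_neg, neg_sub, Complex.coe_smul]

theorem map_smul_sub_eq (f : Y →L[ℂ] Z) (l : ℝ) (a y : Y) :
    f (l • a - y) = (l : ℂ) • f a - Complex.I • f (-(Complex.I • y)) := by
  rw [map_neg, smul_neg, ← map_smul f Complex.I, ← map_neg, neg_I_smul_I_smul, map_sub,
    ← map_smul, Complex.coe_smul]

end general

/-- The iteration runs in the norm ‖Ψ x‖, where one step costs exactly r; the equivalence constants
C and ‖Ψ‖ are paid once, whatever n is. -/
theorem pow_energy_le {S : EnergySpaceDual hsa →L[ℂ] EnergySpace hsa}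
    {Ψ : EnergySpace hsa →L[ℂ] WithLp 2 (H × H)} {C r : ℝ} (hC : 0 ≤ C) (hr : 0 ≤ r)
    (hΨ : ∀ x, ‖x‖ ≤ C * ‖Ψ x‖) (hS : ∀ x, ‖Ψ (S (energyToDual hsa x))‖ ≤ r * ‖Ψ x‖) (n : ℕ) :
    ‖(S ∘L energyToDual hsa) ^ n‖ ≤ C * ‖Ψ‖ * r ^ n := by
  have h1 : ∀ x, ‖Ψ (((S ∘L energyToDual hsa) ^ n) x)‖ ≤ r ^ n * ‖Ψ x‖ := by
    induction n with
    | zero => simp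
    | succ n ih =>
      intro x
      rw [pow_succ', mul_apply_eq_comp, pow_succ', mul_assoc]
      exact (hS _).trans (mul_le_mul_of_nonneg_left (ih x) hr)
  refine ContinuousLinearMap.opNorm_le_bound _ (by positivity) fun x => ?_
  calc _ ≤ C * (r ^ n * (‖Ψ‖ * ‖x‖)) := by
        refine (hΨ _).trans (mul_le_mul_of_nonneg_left ((h1 x).trans ?_) hC)
        exact mul_le_mul_of_nonneg_left (Ψ.le_opNorm x) (by positivity)
    _ = _ := by ring

theorem chargeForm_pow {S S' : EnergySpaceDual hsa →L[ℂ] EnergySpace hsa} {l : ℝ}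
    (hS : ∀ w, kgShift k l (S w) = w) (hS' : ∀ w, kgShift k (-l) (S' w) = w) (n : ℕ)
    (x y : EnergySpace hsa) :
    chargeForm (((S ∘L energyToDual hsa) ^ n) x) y
      = chargeForm x (((-(S' ∘L energyToDual hsa)) ^ n) y) := by
  induction n generalizing x with
  | zero => simp
  | succ n ih =>
    have h1 := chargeForm_kgShift (hS (energyToDual hsa x))
      (hS' (energyToDual hsa (((-(S' ∘L energyToDual hsa)) ^ n) y)))
    have h2 : ∀ z : EnergySpace hsa, chargeForm x (-z) = - chargeForm x z := fun z => by
      have := chargeForm_smul_right (-1) x z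
      rwa [neg_one_smul, neg_one_mul] at this
    rw [pow_succ, mul_apply_eq_comp, ih, pow_succ', mul_apply_eq_comp, neg_apply, h2]
    exact h1

/-- Lax's argument is applied to the n-th power as a whole, so its constant does not compound. The
factor 2 compares the maximum norm of the product with the Hilbert norm. -/
theorem norm_charge_pow_le {S S' : EnergySpaceDual hsa →L[ℂ] EnergySpace hsa} {l C r : ℝ}
    (hC : 0 ≤ C) (hr : 0 ≤ r)
    (hS : ∀ w, kgShift k l (S w) = w) (hS' : ∀ w, kgShift k (-l) (S' w) = w)
    (h1 : ∀ n, ‖(S ∘L energyToDual hsa) ^ n‖ ≤ C * r ^ n)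
    (h2 : ∀ n, ‖(S' ∘L energyToDual hsa) ^ n‖ ≤ C * r ^ n) (n : ℕ) :
    ‖(energyToCharge hsa quarter_le_half ∘L S ∘L chargeToDual hsa quarter_le_half) ^ n‖ ≤
      2 * C * r ^ n := by
  set R := energyToCharge hsa quarter_le_half ∘L S ∘L chargeToDual hsa quarter_le_half
  set j := chargeSwap hsa
  have hRn : ∀ m x, (R ^ m) (energyToCharge hsa quarter_le_half x) =
      energyToCharge hsa quarter_le_half (((S ∘L energyToDual hsa) ^ m) x) := by
    intro m
    induction m with
    | zero => simp
    | succ m ih =>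
      intro x
      rw [pow_succ', mul_apply_eq_comp, ih, pow_succ', mul_apply_eq_comp]
      simp only [R, ContinuousLinearMap.comp_apply, chargeToDual_energyToCharge]
  -- The charge adjoint, conjugated by the swap j, is the adjoint for the inner product of the
  -- charge space.
  have hadj : ∀ x y, inner ℂ (energyToCharge' hsa (((S ∘L energyToDual hsa) ^ n) x))
      (energyToCharge' hsa y) = inner ℂ (energyToCharge' hsa x)
        (energyToCharge' hsa ((j * (-(S' ∘L energyToDual hsa)) ^ n * j) y)) := fun x y => by
    rw [inner_energyToCharge', inner_energyToCharge', mul_apply_eq_comp, mul_apply_eq_comp,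
      chargeSwap_chargeSwap, chargeForm_pow hS hS']
  have hn' : ‖j * (-(S' ∘L energyToDual hsa)) ^ n * j‖ ≤ C * r ^ n := by
    have hj : ‖j‖ ≤ 1 := norm_chargeSwap_le
    refine (norm_mul_mul_le_of_norm_le_one hj _).trans ?_
    exact (norm_neg_pow _ n).trans_le (h2 n)
  have key := norm_apply_le_of_formalAdjoint (energyToCharge' hsa) hadj hC (pow_nonneg hr n)
    (h1 n) hn'
  refine ContinuousLinearMap.opNorm_le_bound _ (by positivity) fun u => ?_
  refine (energyToCharge_denseRange hsa quarter_le_half).induction_on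
    (p := fun u => ‖(R ^ n) u‖ ≤ 2 * C * r ^ n * ‖u‖) u
    (isClosed_le (by fun_prop) (by fun_prop)) fun x => ?_
  rw [hRn]
  calc _ ≤ C * r ^ n * ‖energyToCharge' hsa x‖ := (norm_energyToCharge_le _).trans (key x)
    _ ≤ C * r ^ n * (2 * ‖energyToCharge hsa quarter_le_half x‖) := by
      gcongr
      exact norm_energyToCharge'_le x
    _ = _ := by ring

/-- The set in question is the graph of iK: y = iKx means Kx = −iy. -/
theorem exists_isResolventFamily (hk : SymmetricOnSob hsa k) (hb : BoundedBelow h) :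
    ∃ (R : ℝ → ChargeSpace hsa (1 / 4) →L[ℂ] ChargeSpace hsa (1 / 4)) (ω M : ℝ),
      IsResolventFamily {p | (p.1, -(Complex.I • p.2)) ∈ (chargeKG hsa k quarter_le_half).graph}
        R ω M := by
  obtain ⟨c, hc, Q, hQ, δ, hδ, hQδ⟩ := hb.exists_sqrt hsa
  obtain ⟨C, hC, hΨ⟩ := exists_norm_le_energyMap k hδ hQδ
  set Ψ := energyMap k Q
  set ω₀ := c * (‖japPow hsa (1 / 2)‖ / δ) with hω₀
  have hω₀0 : 0 ≤ ω₀ := by positivity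
  -- The part ω₀ of the threshold serves the energy estimate; the extra c + 1 forces l² ≥ c, as the
  -- invertibility of the pencil requires. Below the threshold S is set to 0.
  have hex : ∀ l : ℝ, ∃ S : EnergySpaceDual hsa →L[ℂ] EnergySpace hsa, ω₀ + (c + 1) < |l| →
      (∀ w, kgShift k l (S w) = w) ∧ ∀ x, S (kgShift k l x) = x := fun l => by
    by_cases hl : ω₀ + (c + 1) < |l|
    · obtain ⟨S, hS⟩ := exists_kgShift_inverse hk (l := l)
        (kgPencil_isUnit hk hδ hQ hQδ (by rw [← sq_abs]; nlinarith))
      exact ⟨S, fun _ => hS⟩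
    · exact ⟨0, fun hl' => absurd hl' hl⟩
  choose S hS using hex
  have hΨS : ∀ l, ω₀ + (c + 1) < |l| → ∀ x, ‖Ψ (S l (energyToDual hsa x))‖
      ≤ 1 / (|l| - (ω₀ + (c + 1))) * ‖Ψ x‖ := fun l hl x => by
    have h1 := norm_energyMap_le hk hc hδ hQ hQδ ((hS l hl).1 (energyToDual hsa x))
    rw [one_div_mul_eq_div, le_div_iff₀ (by linarith)]
    refine le_trans ?_ h1
    rw [mul_comm]
    exact mul_le_mul_of_nonneg_right (by linarith) (norm_nonneg _)
  set ι := energyToCharge hsa quarter_le_half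
  set κ := chargeToDual hsa quarter_le_half
  have hικ : ∀ x, κ (ι x) = energyToDual hsa x := chargeToDual_energyToCharge hsa quarter_le_half
  have hright : ∀ l, ω₀ + (c + 1) < |l| → ∀ w, ((ι ∘L S l ∘L κ) w,
      -(Complex.I • (l • (ι ∘L S l ∘L κ) w - w))) ∈
        (chargeKG hsa k quarter_le_half).graph := fun l hl w => by
    refine (mem_graph_chargeKG hsa k quarter_le_half).mpr ⟨S l (κ w), rfl, ?_⟩
    rw [kgOperator_of_kgShift_eq ((hS l hl).1 (κ w)), ← hικ, ← map_smul, ← map_sub, ← map_smul]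
    exact congrArg κ (I_smul_sub_eq_neg l _ w)
  refine ⟨fun l => ι ∘L S l ∘L κ, ω₀ + (c + 1), 2 * (C * ‖Ψ‖), by positivity, ?_, hright, ?_, ?_⟩
  · intro l hl x y hxy
    obtain ⟨e, rfl, he⟩ := (mem_graph_chargeKG hsa k quarter_le_half).mp hxy
    have h1 : κ (l • ι e - y) = kgShift k l e := by
      rw [kgShift_apply, he, ← hικ]
      exact map_smul_sub_eq κ l _ y
    simp only [ContinuousLinearMap.comp_apply]
    rw [h1, (hS l hl).2]
  · intro l hl n
    have hl' : ω₀ + (c + 1) < |-l| := by rwa [abs_neg]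
    have hr : 0 ≤ 1 / (|l| - (ω₀ + (c + 1))) := one_div_nonneg.mpr (by linarith)
    refine norm_charge_pow_le (by positivity) hr (hS l hl).1 (hS (-l) hl').1
      (pow_energy_le hC hr hΨ (hΨS l hl)) (pow_energy_le hC hr hΨ fun x => ?_) n
    have := hΨS (-l) hl' x
    rwa [abs_neg] at this
  -- The domain contains the range of one resolvent, a composition of a surjection with maps of
  -- dense range.
  · set l : ℝ := ω₀ + (c + 1) + 1
    have hl : ω₀ + (c + 1) < |l| := lt_of_lt_of_le (by simp [l]) (le_abs_self l)
    have hsurj : Function.Surjective (S l) := fun x => ⟨_, (hS l hl).2 x⟩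
    have hdense : DenseRange (ι ∘ S l ∘ κ) :=
      (energyToCharge_denseRange hsa quarter_le_half).comp
        (hsurj.denseRange.comp (chargeToDual_denseRange hsa quarter_le_half) (S l).continuous)
        ι.continuous
    refine hdense.mono ?_
    rintro _ ⟨w, rfl⟩
    exact ⟨(_, _), hright l hl w, rfl⟩

end kleinGordon

end AbstractKG

end

theorem mainTheorem11 {H : Type*} [NormedAddCommGroup H] [InnerProductSpace ℂ H] [CompleteSpace H]
    (h : H →ₗ.[ℂ] H) (hsa : IsSelfAdjoint h)
    (k : AbstractKG.Sob hsa (1 / 2) →L[ℂ] H) (hk : AbstractKG.SymmetricOnSob hsa k)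
    (hb : AbstractKG.BoundedBelow h) :
    ∃ W : AbstractKG.C0Group (AbstractKG.ChargeSpace hsa (1 / 4)),
      W.generator = AbstractKG.chargeKG hsa k AbstractKG.quarter_le_half := by
  obtain ⟨R, ω, M, hR⟩ := AbstractKG.exists_isResolventFamily hk hb
  obtain ⟨W, hW⟩ := hR.exists_c0Group
  refine ⟨W, LinearPMap.eq_of_eq_graph ?_⟩
  ext ⟨x, w⟩
  rw [W.mem_graph_generator, hW, Set.mem_ofPred_eq]
  -- The derivative of W t x is i w, and the pair (x, i w) is in the graph of iK exactly when (x,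
  -- −i(i w)) = (x, w) is in that of K.
  exact iff_of_eq (congrArg _ (congrArg _ (AbstractKG.neg_I_smul_I_smul w)))
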